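/- Let $G$ be a locally compact, second countable, Hausdorff abelian group, and let $P\subset G$ be a closed subsemigroup containing $0$ with $P-P=G$ and with dense interior (in $P$), having an order unit: some $a_0\in \mathrm{Int}(P)$ such that for every $s\in G$ there is an integer $n\ge 1$ with $na_0-s\in \mathrm{Int}(P)$. Let $c:G\to\mathbb{R}$ be a continuous homomorphism. Let $Y_u$ be the space of closed sets $A\subset G$ with $A\neq\emptyset$, $A\ne G$ and $-P+A\subset A$, with the topology induced by the Fell topology and with the $G$-action $(A,s)\mapsto A+s$, and let $X_u=\{A\in Y_u: 0\in A\}$. Let $\beta\neq 0$ be real, and let $\mu$ be a non-zero Radon measure on $Y_u$ that is $e^{-\beta c}$-conformal, i.e. $\mu(E+s)=e^{-\beta c(s)}\mu(E)$ for all $s\in G$ and all Borel $E\subset Y_u$, and ergodic, i.e. every $G$-invariant Borel set is null or co-null. Let $V^\mu=\{V^\mu_a\}_{a\in P}$ be the semigroup of isometries on $L^2(X_u,\mu)\subset L^2(Y_u,\mu)$ obtained by restricting the operators $U_af(A)=e^{\beta c(a)/2}f(A-a)$, and let $V=\{V_a\}_{a\in P}$ be a semigroup of isometries on a Hilbert space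 $H$ that is unitarily equivalent to $V^\mu$. For $t\in\mathbb{R}$, let $V^t$ be the semigroup of isometries $V^t_a=e^{itc(a)}V_a$. A semigroup of isometries $W=\{W_a\}_{a\in P}$ is called $e^{-\beta c/2}$-conformal if there is a non-zero linear functional $\phi$ on $\bigcup_{a\in P}\ker W_a^*$ that is bounded on $\ker W_a^*$ for every $a\in P$ and satisfies $\phi(W_a\xi)=e^{-\beta c(a)/2}\phi(\xi)$ for all $a\in P$ and all $\xi$ in its domain. Then the following are equivalent. 1. There is a $\sigma$-finite, $G$-invariant Borel measure $\nu$ on $Y_u$ such that $\nu$ and $\mu$ are absolutely continuous with respect to each other. 2. For every $t\in\mathbb{R}$, $V$ and $V^t$ are unitarily equivalent. 3. There exists $\delta>0$ such that $V$ and $V^t$ are unitarily equivalent for every $t\in[0,\delta]$. 4. There exists $\delta>0$ such that $V^t$ is $e^{-\beta c/2}$-conformal for every $t\in[0,\delta]$. -/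

import Mathlib

open MeasureTheory TopologicalSpace Set
open scoped ENNReal

noncomputable section

namespace ConformalIsometries

/-! ### Semigroups of isometries -/

section Semigroups

variable {G : Type*} [AddCommGroup G]

/-- A semigroup of isometries on `H` indexed by `P`. -/
structure IsometricSemigroup (P : AddSubmonoid G) (H : Type*) [NormedAddCommGroup H]
    [InnerProductSpace ℂ H] where
  /-- the isometry `V_a` -/
  op : P → H →ₗᵢ[ℂ] H
  map_zero' : ∀ ξ : H, op 0 ξ = ξ
  map_add' : ∀ (a b : P) (ξ : H), op (a + b) ξ = op a (op b ξ)

namespace IsometricSemigroup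

variable {P : AddSubmonoid G} {H : Type*} [NormedAddCommGroup H] [InnerProductSpace ℂ H]

/-- Unitary equivalence of two semigroups of isometries. -/
def UnitarilyEquivalent {K : Type*} [NormedAddCommGroup K] [InnerProductSpace ℂ K]
    (V : IsometricSemigroup P H) (W : IsometricSemigroup P K) : Prop :=
  ∃ U : H ≃ₗᵢ[ℂ] K, ∀ (a : P) (ξ : H), U (V.op a ξ) = W.op a (U ξ)

/-- The twisted semigroup `V^t_a = e^{itc(a)} V_a`. -/
def twist (V : IsometricSemigroup P H) (c : G →+ ℝ) (t : ℝ) : IsometricSemigroup P H where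
  op a :=
    { toLinearMap := Complex.exp (Complex.I * (t * c (a : G) : ℝ)) • (V.op a).toLinearMap
      norm_map' := fun ξ => by
        change ‖Complex.exp (Complex.I * (t * c (a : G) : ℝ)) • V.op a ξ‖ = ‖ξ‖
        rw [norm_smul, mul_comm Complex.I, Complex.norm_exp_ofReal_mul_I, one_mul,
          LinearIsometry.norm_map] }
  map_zero' ξ := by
    change Complex.exp (Complex.I * (t * c ((0 : P) : G) : ℝ)) • V.op 0 ξ = ξ
    simp [V.map_zero']
  map_add' a b ξ := by
    change Complex.exp (Complex.I * (t * c ((a + b : P) : G) : ℝ)) • V.op (a + b) ξ =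
      Complex.exp (Complex.I * (t * c (a : G) : ℝ)) •
        V.op a (Complex.exp (Complex.I * (t * c (b : G) : ℝ)) • V.op b ξ)
    rw [V.map_add', map_smul, smul_smul, ← Complex.exp_add, AddSubmonoid.coe_add, map_add]
    congr 2
    push_cast
    ring

theorem twist_op_apply (V : IsometricSemigroup P H) (c : G →+ ℝ) (t : ℝ) (a : P) (ξ : H) :
    (V.twist c t).op a ξ = Complex.exp (Complex.I * (t * c (a : G) : ℝ)) • V.op a ξ := rfl

variable [CompleteSpace H]

/-- The Hilbert space adjoint `V_a^*`. -/
def adj (V : IsometricSemigroup P H) (a : P) : H →L[ℂ] H :=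
  ContinuousLinearMap.adjoint (V.op a).toContinuousLinearMap

theorem adj_op (V : IsometricSemigroup P H) (a : P) (ξ : H) : V.adj a (V.op a ξ) = ξ := by
  refine ext_inner_right ℂ fun η => ?_
  rw [adj, ContinuousLinearMap.adjoint_inner_left]
  exact (V.op a).inner_map_map ξ η

theorem adj_add (V : IsometricSemigroup P H) (a b : P) (ξ : H) :
    V.adj (a + b) ξ = V.adj b (V.adj a ξ) := by
  refine ext_inner_right ℂ fun η => ?_
  simp only [adj, ContinuousLinearMap.adjoint_inner_left]
  change inner ℂ ξ (V.op (a + b) η) = inner ℂ ξ (V.op a (V.op b η))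
  rw [V.map_add']

/-- The subspace `D_V = ⋃_{a ∈ P} Ker(V_a^*)`. -/
def domain (V : IsometricSemigroup P H) : Submodule ℂ H where
  carrier := {ξ | ∃ a : P, V.adj a ξ = 0}
  zero_mem' := ⟨0, map_zero _⟩
  add_mem' := by
    rintro ξ η ⟨a, ha⟩ ⟨b, hb⟩
    refine ⟨a + b, ?_⟩
    have h₁ : V.adj (a + b) ξ = 0 := by rw [V.adj_add, ha, map_zero]
    have h₂ : V.adj (a + b) η = 0 := by rw [add_comm, V.adj_add, hb, map_zero]
    rw [map_add, h₁, h₂, add_zero]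
  smul_mem' := by
    rintro z ξ ⟨a, ha⟩
    exact ⟨a, by rw [map_smul, ha, smul_zero]⟩

theorem op_mem_domain (V : IsometricSemigroup P H) (a : P) {ξ : H} (hξ : ξ ∈ V.domain) :
    V.op a ξ ∈ V.domain := by
  obtain ⟨b, hb⟩ := hξ
  exact ⟨a + b, by rw [V.adj_add, V.adj_op, hb]⟩

/-- The isometry `V_a` as a linear map of `D_V` into itself. -/
def opDomain (V : IsometricSemigroup P H) (a : P) : V.domain →ₗ[ℂ] V.domain :=
  (V.op a).toLinearMap.restrict fun _ hξ => V.op_mem_domain a hξ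

/-- The space `L_V` of the linear functionals on `D_V` whose restriction to `Ker(V_a^*)` is bounded
for every `a ∈ P`. -/
def functionals (V : IsometricSemigroup P H) : Submodule ℂ (V.domain →ₗ[ℂ] ℂ) where
  carrier := {φ | ∀ a : P, ∃ C : ℝ, ∀ ξ : V.domain, V.adj a (ξ : H) = 0 → ‖φ ξ‖ ≤ C * ‖(ξ : H)‖}
  zero_mem' := fun _ => ⟨0, fun ξ _ => by simp⟩
  add_mem' := by
    intro φ ψ hφ hψ a
    obtain ⟨C, hC⟩ := hφ a
    obtain ⟨D, hD⟩ := hψ a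
    refine ⟨C + D, fun ξ hξ => ?_⟩
    rw [LinearMap.add_apply, add_mul]
    exact (norm_add_le _ _).trans (add_le_add (hC ξ hξ) (hD ξ hξ))
  smul_mem' := by
    intro z φ hφ a
    obtain ⟨C, hC⟩ := hφ a
    refine ⟨‖z‖ * C, fun ξ hξ => ?_⟩
    rw [LinearMap.smul_apply, norm_smul, mul_assoc]
    exact mul_le_mul_of_nonneg_left (hC ξ hξ) (norm_nonneg z)

/-- `V` is `e^{-βc/2}`-conformal: there is a non-zero `φ ∈ L_V` such that, for all `a ∈ P`,
`T_a φ = e^{-βc(a)/2} φ`, where `T_a φ = φ ∘ V_a`. -/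
def IsConformal (V : IsometricSemigroup P H) (c : G →+ ℝ) (β : ℝ) : Prop :=
  ∃ φ ∈ V.functionals, φ ≠ 0 ∧
    ∀ a : P, φ ∘ₗ V.opDomain a = (Real.exp (-(β * c (a : G)) / 2) : ℂ) • φ

end IsometricSemigroup

end Semigroups

/-! ### The dynamical system of hereditary closed sets -/

/-- The Fell topology on the set of closed subsets of `G`: a subbase is given by the sets of the
closed sets that miss a given compact set and of the closed sets that hit a given open set. -/
@[reducible] def fellTopology (G : Type*) [TopologicalSpace G] : TopologicalSpace (Closeds G) :=
  TopologicalSpace.generateFrom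
    ({S | ∃ K : Set G, IsCompact K ∧ S = {A : Closeds G | Disjoint (A : Set G) K}} ∪
      {S | ∃ U : Set G, IsOpen U ∧ S = {A : Closeds G | ((A : Set G) ∩ U).Nonempty}})

variable {G : Type*} [AddCommGroup G] [TopologicalSpace G]

/-- The space `Y_u` of closed sets `A ⊆ G` with `A ≠ ∅`, `-P + A ⊆ A` and `A ≠ G`. -/
def YSpace (P : AddSubmonoid G) : Type _ :=
  {A : Closeds G // (A : Set G).Nonempty ∧
    (∀ a ∈ P, ∀ x ∈ (A : Set G), -a + x ∈ (A : Set G)) ∧ (A : Set G) ≠ univ}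

/-- `Y_u` carries the topology induced by the Fell topology. -/
instance YSpace.instTopologicalSpace (P : AddSubmonoid G) : TopologicalSpace (YSpace P) :=
  (fellTopology G).induced Subtype.val

/-- `Y_u` carries its Borel `σ`-algebra. -/
instance YSpace.instMeasurableSpace (P : AddSubmonoid G) : MeasurableSpace (YSpace P) :=
  borel (YSpace P)

instance YSpace.instBorelSpace (P : AddSubmonoid G) : BorelSpace (YSpace P) := ⟨rfl⟩

/-- The subset `X_u` of those `A ∈ Y_u` that contain `0`. -/
def XSet (P : AddSubmonoid G) : Set (YSpace P) := {A | (0 : G) ∈ (A.1 : Set G)}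

theorem YSpace.ext_mem {P : AddSubmonoid G} {A B : YSpace P}
    (h : ∀ x, x ∈ (A.1 : Set G) ↔ x ∈ (B.1 : Set G)) : A = B :=
  Subtype.ext (SetLike.coe_injective (Set.ext h))

variable [IsTopologicalAddGroup G]

/-- The translate `A + s` of a point `A` of `Y_u`; the set `A + s` is `{x | x - s ∈ A}`. -/
def translate {P : AddSubmonoid G} (s : G) (A : YSpace P) : YSpace P :=
  ⟨⟨{x | x - s ∈ (A.1 : Set G)}, A.1.isClosed.preimage (continuous_sub_right s)⟩, by
    obtain ⟨x, hx⟩ := A.2.1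
    exact ⟨x + s, by simpa using hx⟩, by
    intro a ha x hx
    have h := A.2.2.1 a ha (x - s) hx
    have e : -a + x - s = -a + (x - s) := by abel
    change -a + x - s ∈ (A.1 : Set G)
    rw [e]
    exact h, by
    intro h
    refine A.2.2.2 (eq_univ_of_forall fun x => ?_)
    have hx : x + s ∈ {x | x - s ∈ (A.1 : Set G)} := by
      change {x | x - s ∈ (A.1 : Set G)} = univ at h
      rw [h]
      trivial
    simpa using hx⟩

theorem mem_translate {P : AddSubmonoid G} (s : G) (A : YSpace P) (x : G) :
    x ∈ ((translate s A).1 : Set G) ↔ x - s ∈ (A.1 : Set G) := Iff.rfl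

theorem translate_zero {P : AddSubmonoid G} (A : YSpace P) : translate 0 A = A :=
  YSpace.ext_mem fun x => by rw [mem_translate, sub_zero]

theorem translate_translate {P : AddSubmonoid G} (s t : G) (A : YSpace P) :
    translate s (translate t A) = translate (s + t) A :=
  YSpace.ext_mem fun x => by rw [mem_translate, mem_translate, mem_translate, sub_sub]

theorem continuous_translate {P : AddSubmonoid G} (s : G) :
    Continuous (translate s : YSpace P → YSpace P) := by
  let _ : TopologicalSpace (Closeds G) := fellTopology G
  have hval : Continuous (Subtype.val : YSpace P → Closeds G) := continuous_induced_dom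
  refine continuous_induced_rng.2 (continuous_generateFrom_iff.2 ?_)
  rintro S (⟨K, hK, rfl⟩ | ⟨U, hU, rfl⟩)
  · have ho : IsOpen {A : Closeds G | Disjoint (A : Set G) ((fun x => x + s) ⁻¹' K)} :=
      TopologicalSpace.isOpen_generateFrom_of_mem (Or.inl
        ⟨_, (Homeomorph.addRight s).isCompact_preimage.2 hK, rfl⟩)
    suffices e : (fun A : YSpace P => (translate s A).1) ⁻¹'
        {A : Closeds G | Disjoint (A : Set G) K} = (fun A : YSpace P => A.1) ⁻¹'
          {A : Closeds G | Disjoint (A : Set G) ((fun x => x + s) ⁻¹' K)} by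
      exact e ▸ ho.preimage hval
    refine Set.ext fun A => ?_
    simp only [mem_preimage, mem_ofPred_eq, Set.disjoint_left]
    constructor
    · intro h x hx hxK
      exact h (a := x + s) (by rw [mem_translate, add_sub_cancel_right]; exact hx) hxK
    · intro h x hx hxK
      exact h (a := x - s) hx (by simpa using hxK)
  · have ho : IsOpen {A : Closeds G | ((A : Set G) ∩ ((fun x => x + s) ⁻¹' U)).Nonempty} :=
      TopologicalSpace.isOpen_generateFrom_of_mem (Or.inr
        ⟨_, hU.preimage (continuous_add_const s), rfl⟩)
    suffices e : (fun A : YSpace P => (translate s A).1) ⁻¹'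
        {A : Closeds G | ((A : Set G) ∩ U).Nonempty} = (fun A : YSpace P => A.1) ⁻¹'
          {A : Closeds G | ((A : Set G) ∩ ((fun x => x + s) ⁻¹' U)).Nonempty} by
      exact e ▸ ho.preimage hval
    refine Set.ext fun A => ?_
    simp only [mem_preimage, mem_ofPred_eq]
    constructor
    · rintro ⟨x, hx, hxU⟩
      exact ⟨x - s, hx, by simpa using hxU⟩
    · rintro ⟨x, hx, hxU⟩
      exact ⟨x + s, by rw [mem_translate, add_sub_cancel_right]; exact hx, hxU⟩

theorem measurable_translate {P : AddSubmonoid G} (s : G) :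
    Measurable (translate s : YSpace P → YSpace P) :=
  (continuous_translate s).measurable

theorem image_translate {P : AddSubmonoid G} (s : G) (E : Set (YSpace P)) :
    translate s '' E = translate (-s) ⁻¹' E := by
  ext A
  constructor
  · rintro ⟨B, hB, rfl⟩
    simpa [translate_translate, translate_zero] using hB
  · intro hA
    exact ⟨translate (-s) A, hA, by simp [translate_translate, translate_zero]⟩

/-! ### Conformal, invariant and ergodic measures on `Y_u` -/

/-- `μ` is `e^{-βc}`-conformal: `μ(E + s) = e^{-βc(s)} μ(E)` for all `s ∈ G` and all Borel `E`. -/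
def IsConformalMeasure {P : AddSubmonoid G} (c : G →+ ℝ) (β : ℝ) (μ : Measure (YSpace P)) : Prop :=
  ∀ (s : G) (E : Set (YSpace P)), MeasurableSet E →
    μ (translate s '' E) = ENNReal.ofReal (Real.exp (-β * c s)) * μ E

/-- `ν` is `G`-invariant: `ν(E + s) = ν(E)` for all `s ∈ G` and all Borel `E`. -/
def IsInvariantMeasure {P : AddSubmonoid G} (ν : Measure (YSpace P)) : Prop :=
  ∀ (s : G) (E : Set (YSpace P)), MeasurableSet E → ν (translate s '' E) = ν E

/-- `μ` is ergodic: every `G`-invariant Borel set is null or co-null. -/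
def IsErgodicMeasure {P : AddSubmonoid G} (μ : Measure (YSpace P)) : Prop :=
  ∀ E : Set (YSpace P), MeasurableSet E → (∀ s : G, translate s '' E = E) → μ E = 0 ∨ μ Eᶜ = 0

/-! ### The Koopman representation and the semigroup `V^μ` -/

section Koopman

variable {P : AddSubmonoid G} {c : G →+ ℝ} {β : ℝ} {μ : Measure (YSpace P)}

theorem IsConformalMeasure.map_translate (hμ : IsConformalMeasure c β μ) (s : G) :
    μ.map (translate (-s)) = ENNReal.ofReal (Real.exp (-β * c s)) • μ := by
  ext E hE
  rw [Measure.map_apply (measurable_translate _) hE, ← image_translate, hμ s E hE,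
    Measure.smul_apply, smul_eq_mul]

theorem IsConformalMeasure.quasiMeasurePreserving (hμ : IsConformalMeasure c β μ) (s : G) :
    Measure.QuasiMeasurePreserving (translate (-s)) μ μ :=
  ⟨measurable_translate _, by
    rw [hμ.map_translate]
    exact Measure.smul_absolutelyContinuous⟩

/-- The function `A ↦ e^{βc(s)/2} f(A - s)`. -/
def koopmanFun (c : G →+ ℝ) (β : ℝ) (s : G) (f : YSpace P → ℂ) (A : YSpace P) : ℂ :=
  (Real.exp (β * c s / 2) : ℂ) * f (translate (-s) A)

theorem IsConformalMeasure.eLpNorm_koopmanFun (hμ : IsConformalMeasure c β μ) (s : G)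
    {f : YSpace P → ℂ} (hf : AEStronglyMeasurable f μ) :
    eLpNorm (koopmanFun c β s f) 2 μ = eLpNorm f 2 μ := by
  have hmap : eLpNorm (f ∘ translate (-s)) 2 μ =
      ENNReal.ofReal (Real.exp (-β * c s / 2)) * eLpNorm f 2 μ := by
    rw [← eLpNorm_map_measure, hμ.map_translate, eLpNorm_smul_measure_of_ne_top (by simp),
      smul_eq_mul]
    · congr 1
      rw [ENNReal.ofReal_rpow_of_pos (Real.exp_pos _), ← Real.exp_mul]
      congr 2
      simp
      ring
    · rw [hμ.map_translate]
      exact hf.smul_measure _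
    · exact (measurable_translate _).aemeasurable
  have hfun : koopmanFun c β s f = (Real.exp (β * c s / 2) : ℂ) • (f ∘ translate (-s)) := rfl
  rw [hfun, eLpNorm_const_smul, hmap, ← mul_assoc]
  have hexp : ‖(Real.exp (β * c s / 2) : ℂ)‖ₑ = ENNReal.ofReal (Real.exp (β * c s / 2)) := by
    rw [← ofReal_norm, Complex.norm_real, Real.norm_of_nonneg (Real.exp_pos _).le]
  rw [hexp, ← ENNReal.ofReal_mul (Real.exp_pos _).le, ← Real.exp_add]
  have h0 : β * c s / 2 + -β * c s / 2 = 0 := by ring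
  rw [h0, Real.exp_zero, ENNReal.ofReal_one, one_mul]

theorem IsConformalMeasure.koopmanFun_congr (hμ : IsConformalMeasure c β μ) (s : G)
    {f g : YSpace P → ℂ} (h : f =ᵐ[μ] g) : koopmanFun c β s f =ᵐ[μ] koopmanFun c β s g := by
  filter_upwards [(hμ.quasiMeasurePreserving s).ae h] with A hA
  rw [koopmanFun, koopmanFun, hA]

theorem IsConformalMeasure.memLp_koopmanFun (hμ : IsConformalMeasure c β μ) (s : G)
    {f : YSpace P → ℂ} (hf : MemLp f 2 μ) : MemLp (koopmanFun c β s f) 2 μ := by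
  refine ⟨?_, ?_⟩
  · exact (hf.1.comp_quasiMeasurePreserving (hμ.quasiMeasurePreserving s)).const_mul _
  · rw [hμ.eLpNorm_koopmanFun s hf.1]
    exact hf.2

/-- The operator `U_s f(A) = e^{βc(s)/2} f(A - s)` on `L²(Y_u, μ)`. -/
def koopman (hμ : IsConformalMeasure c β μ) (s : G) : Lp ℂ 2 μ →ₗᵢ[ℂ] Lp ℂ 2 μ where
  toFun f := MemLp.toLp (koopmanFun c β s f) (hμ.memLp_koopmanFun s (Lp.memLp f))
  map_add' f g := by
    rw [← MemLp.toLp_add]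
    refine (MemLp.toLp_eq_toLp_iff _ _).2 ?_
    filter_upwards [hμ.koopmanFun_congr s (Lp.coeFn_add f g)] with A hA
    rw [hA]
    simp only [koopmanFun, Pi.add_apply]
    ring
  map_smul' z f := by
    rw [RingHom.id_apply, ← MemLp.toLp_const_smul]
    refine (MemLp.toLp_eq_toLp_iff _ _).2 ?_
    filter_upwards [hμ.koopmanFun_congr s (Lp.coeFn_smul z f)] with A hA
    rw [hA]
    simp only [koopmanFun, Pi.smul_apply, smul_eq_mul]
    ring
  norm_map' f := by
    change ‖MemLp.toLp (koopmanFun c β s f) (hμ.memLp_koopmanFun s (Lp.memLp f))‖ = ‖f‖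
    rw [Lp.norm_toLp, hμ.eLpNorm_koopmanFun s (Lp.memLp f).1, Lp.norm_def]

theorem koopman_coeFn (hμ : IsConformalMeasure c β μ) (s : G) (f : Lp ℂ 2 μ) :
    koopman hμ s f =ᵐ[μ] koopmanFun c β s f :=
  MemLp.coeFn_toLp (hμ.memLp_koopmanFun s (Lp.memLp f))

theorem koopman_zero (hμ : IsConformalMeasure c β μ) (f : Lp ℂ 2 μ) : koopman hμ 0 f = f := by
  refine Lp.ext ((koopman_coeFn hμ 0 f).trans (Filter.Eventually.of_forall fun A => ?_))
  simp [koopmanFun, translate_zero]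

theorem koopman_add (hμ : IsConformalMeasure c β μ) (s t : G) (f : Lp ℂ 2 μ) :
    koopman hμ (s + t) f = koopman hμ s (koopman hμ t f) := by
  refine Lp.ext ?_
  filter_upwards [koopman_coeFn hμ (s + t) f, koopman_coeFn hμ s (koopman hμ t f),
    hμ.koopmanFun_congr s (koopman_coeFn hμ t f)] with A h₁ h₂ h₃
  rw [h₁, h₂, h₃]
  simp only [koopmanFun, translate_translate]
  rw [← mul_assoc, ← Complex.ofReal_mul, ← Real.exp_add, map_add]
  congr 2
  · congr 2
    ring
  · congr 1
    abel

/-- `L²(X_u, μ)` as a subspace of `L²(Y_u, μ)`: the functions that vanish almost everywhere outside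
`X_u`. -/
def L2X (μ : Measure (YSpace P)) : Submodule ℂ (Lp ℂ 2 μ) where
  carrier := {f | ∀ᵐ A ∂μ, A ∉ XSet P → f A = 0}
  zero_mem' := by
    filter_upwards [Lp.coeFn_zero ℂ 2 μ] with A hA _
    rw [hA, Pi.zero_apply]
  add_mem' := by
    intro f g hf hg
    change ∀ᵐ A ∂μ, A ∉ XSet P → (f + g : Lp ℂ 2 μ) A = 0
    filter_upwards [Lp.coeFn_add f g, hf, hg] with A h hf hg hA
    rw [h, Pi.add_apply, hf hA, hg hA, add_zero]
  smul_mem' := by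
    intro z f hf
    change ∀ᵐ A ∂μ, A ∉ XSet P → (z • f : Lp ℂ 2 μ) A = 0
    filter_upwards [Lp.coeFn_smul z f, hf] with A h hf hA
    rw [h, Pi.smul_apply, hf hA, smul_zero]

theorem mem_XSet_of_translate_neg {a : G} (ha : a ∈ P) {A : YSpace P}
    (hA : translate (-a) A ∈ XSet P) : A ∈ XSet P := by
  have h : (0 : G) - -a ∈ (A.1 : Set G) := hA
  have h' := A.2.2.1 a ha _ h
  have e : -a + (0 - -a) = (0 : G) := by abel
  rw [e] at h'
  exact h'

theorem koopman_mem_L2X (hμ : IsConformalMeasure c β μ) {a : G} (ha : a ∈ P) {f : Lp ℂ 2 μ}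
    (hf : f ∈ L2X μ) : koopman hμ a f ∈ L2X μ := by
  have hf' : ∀ᵐ A ∂μ, A ∉ XSet P → f A = 0 := hf
  change ∀ᵐ A ∂μ, A ∉ XSet P → koopman hμ a f A = 0
  filter_upwards [koopman_coeFn hμ a f, (hμ.quasiMeasurePreserving a).ae hf'] with A h₁ h₂ hA
  rw [h₁, koopmanFun, h₂ fun h => hA (mem_XSet_of_translate_neg ha h), mul_zero]

/-- The semigroup `V^μ` of isometries on `L²(X_u, μ)`: `V^μ_a` is the restriction of `U_a`. -/
def semigroupOfMeasure (hμ : IsConformalMeasure c β μ) : IsometricSemigroup P (L2X μ) where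
  op a :=
    { toLinearMap := (koopman hμ (a : G)).toLinearMap.restrict
        fun _ hf => koopman_mem_L2X hμ a.2 hf
      norm_map' := fun f => (koopman hμ (a : G)).norm_map f }
  map_zero' f := Subtype.ext (koopman_zero hμ f)
  map_add' a b f := Subtype.ext (koopman_add hμ a b f)

end Koopman

end ConformalIsometries

end

open ConformalIsometries

/-! All four conditions are governed by cocycle-type equations for `c` on the system (`Y_u`, `G`,
`μ`).

From an invariant measure to the twists: if `ν` is invariant and equivalent to `μ`, its density `h`
satisfies `h(A + s) = e^{βc(s)} h(A)` almost everywhere. Since `β ≠ 0`, `F = (log h)/β` satisfies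
`F(A + s) = F(A) + c(s)`, and multiplication by `e^{itF}` intertwines `V^μ` with its twist by `t`
(`exists_translate_eq_add`, `unitarilyEquivalent_twist_of_translate_eq_add`). Moreover, `f ↦ ∫ f dμ`
is always a conformal functional for `V^μ` (`isConformal_semigroupOfMeasure`), so every semigroup
unitarily equivalent to `V^μ` is conformal.

The substantial implication is from conformality of the twists back to an invariant measure. By the
Riesz theorem on sets exhausting `Y_u`, a conformal functional of `V^t` is integration against local
densities, which glue to an eigenfunction `u_t(A + s) = e^{itc(s)} u_t(A)`
(`exists_isEigenfunction_of_isConformal`). By ergodicity `|u_t|` is constant and `u_t` is unique up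
to a scalar. A measurable selection then gives a jointly measurable family `k(t, A)` of unimodular
eigenfunctions for `t` in a set `T` of positive measure, extended by zero
(`exists_eigenfunction_family`).

Let `J_A` be the Fourier transform of `k(·, A)`. Replacing `A` by `A + s` translates `J_A` by
`c(s)/2π`. Since `J_A` is continuous, vanishes at infinity and is almost always non-zero, the
integral of `e^{2πβw}` over `{|J_A| > ε}` is finite, is multiplied by `e^{βc(s)}` under translation
by `s`, and is positive almost everywhere for some `ε` (`exists_density_of_eigenfunctions`). Taken
as a density against `μ`, it gives the invariant measure. -/

namespace ConformalIsometries

set_option linter.unusedSectionVars false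

open Filter Topology Pointwise

/-! ### The Fell topology on `Y_u` and the continuity of the action -/

section FellTopology

variable {G : Type*} [AddCommGroup G] [TopologicalSpace G] {P : AddSubmonoid G}

theorem YSpace.isOpen_miss {K : Set G} (hK : IsCompact K) :
    IsOpen {A : YSpace P | Disjoint (A.1 : Set G) K} := by
  let _ : TopologicalSpace (Closeds G) := fellTopology G
  have hval : Continuous (Subtype.val : YSpace P → Closeds G) := continuous_induced_dom
  exact (TopologicalSpace.isOpen_generateFrom_of_mem (Or.inl ⟨K, hK, rfl⟩) :
    IsOpen {A : Closeds G | Disjoint (A : Set G) K}).preimage hval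

theorem YSpace.isOpen_hit {U : Set G} (hU : IsOpen U) :
    IsOpen {A : YSpace P | ((A.1 : Set G) ∩ U).Nonempty} := by
  let _ : TopologicalSpace (Closeds G) := fellTopology G
  have hval : Continuous (Subtype.val : YSpace P → Closeds G) := continuous_induced_dom
  exact (TopologicalSpace.isOpen_generateFrom_of_mem (Or.inr ⟨U, hU, rfl⟩) :
    IsOpen {A : Closeds G | ((A : Set G) ∩ U).Nonempty}).preimage hval

theorem YSpace.topology_eq : YSpace.instTopologicalSpace P = generateFrom
    ({S | ∃ K : Set G, IsCompact K ∧ S = {A : YSpace P | Disjoint (A.1 : Set G) K}} ∪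
      {S | ∃ U : Set G, IsOpen U ∧ S = {A : YSpace P | ((A.1 : Set G) ∩ U).Nonempty}}) := by
  refine le_antisymm ?_ ?_
  · refine le_generateFrom ?_
    rintro S (⟨K, hK, rfl⟩ | ⟨U, hU, rfl⟩)
    · exact isOpen_miss hK
    · exact isOpen_hit hU
  · change _ ≤ (fellTopology G).induced Subtype.val
    rw [fellTopology, induced_generateFrom_eq]
    refine le_generateFrom ?_
    rintro S ⟨S, (⟨K, hK, rfl⟩ | ⟨U, hU, rfl⟩), rfl⟩
    · exact isOpen_generateFrom_of_mem (Or.inl ⟨K, hK, rfl⟩)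
    · exact isOpen_generateFrom_of_mem (Or.inr ⟨U, hU, rfl⟩)

theorem YSpace.measurableSet_mem (x : G) : MeasurableSet {A : YSpace P | x ∈ (A.1 : Set G)} := by
  have h := (isOpen_miss (P := P) (isCompact_singleton (x := x))).measurableSet.compl
  convert h using 1
  ext A
  simp

theorem YSpace.sub_mem (A : YSpace P) {a x : G} (ha : a ∈ P) (hx : x ∈ (A.1 : Set G)) :
    x - a ∈ (A.1 : Set G) := by
  have := A.2.2.1 a ha x hx
  rwa [neg_add_eq_sub] at this

/-- A compact set disjoint from `A` can be enlarged, still disjoint from `A`, to a finite union of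
compact closures of basic open sets. Second countability makes functions on products Borel
measurable and `L²` separable. -/
theorem YSpace.secondCountableTopology [LocallyCompactSpace G] [SecondCountableTopology G]
    [T2Space G] : SecondCountableTopology (YSpace P) := by
  let 𝒞 : Set (Set (Set G)) := {t | t.Finite ∧ t ⊆ countableBasis G}
  let 𝒮 : Set (Set (YSpace P)) :=
    (fun t : Set (Set G) => {A : YSpace P | Disjoint (A.1 : Set G) (⋃ U ∈ t, closure U)}) ''
        {t ∈ 𝒞 | IsCompact (⋃ U ∈ t, closure U)} ∪
      (fun U : Set G => {A : YSpace P | ((A.1 : Set G) ∩ U).Nonempty}) '' countableBasis G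
  refine ⟨𝒮, ?_, ?_⟩
  · refine (Set.Countable.image ?_ _).union ((countable_countableBasis G).image _)
    exact (Set.countable_ofPred_finite_subset (countable_countableBasis G)).mono
      (Set.sep_subset _ _)
  · rw [YSpace.topology_eq (P := P)]
    refine le_antisymm ?_ ?_
    · refine le_generateFrom ?_
      rw [← YSpace.topology_eq]
      rintro S (⟨t, ⟨-, ht⟩, rfl⟩ | ⟨U, hU, rfl⟩)
      · exact isOpen_miss ht
      · exact isOpen_hit (isOpen_of_mem_countableBasis hU)
    · refine le_generateFrom ?_
      rintro S (⟨K, hK, rfl⟩ | ⟨U, hU, rfl⟩)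
      · refine (@isOpen_iff_forall_mem_open _ (generateFrom 𝒮) _).2 ?_
        intro A hA
        have h : ∀ x ∈ K, ∃ B ∈ countableBasis G, x ∈ B ∧ IsCompact (closure B) ∧
            Disjoint (A.1 : Set G) (closure B) := by
          intro x hx
          obtain ⟨C, hC, hxC, hCA⟩ := exists_compact_subset A.1.isClosed.isOpen_compl
            (fun h => Set.disjoint_left.1 hA h hx : x ∈ (A.1 : Set G)ᶜ)
          obtain ⟨B, hB, hxB, hBC⟩ := (isBasis_countableBasis G).exists_subset_of_mem_open
            hxC isOpen_interior
          have hcl : closure B ⊆ C := closure_minimal (hBC.trans interior_subset) hC.isClosed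
          exact ⟨B, hB, hxB, hC.of_isClosed_subset isClosed_closure hcl,
            Set.subset_compl_iff_disjoint_left.1 (hcl.trans hCA)⟩
        choose! B hB hxB hBc hBA using h
        obtain ⟨t, htK, htc⟩ := hK.elim_nhds_subcover B
          (fun x hx => (isOpen_of_mem_countableBasis (hB x hx)).mem_nhds (hxB x hx))
        have hcomp : IsCompact (⋃ U ∈ B '' t, closure U) :=
          (t.finite_toSet.image B).isCompact_biUnion fun U hU => by
            obtain ⟨x, hx, rfl⟩ := hU
            exact hBc x (htK x hx)
        refine ⟨{A : YSpace P | Disjoint (A.1 : Set G) (⋃ U ∈ B '' t, closure U)}, ?_,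
          isOpen_generateFrom_of_mem (Or.inl ⟨B '' t, ⟨⟨t.finite_toSet.image B, ?_⟩, hcomp⟩, rfl⟩),
          ?_⟩
        · intro A' hA'
          refine Disjoint.mono_right ?_ hA'
          refine (show K ≤ _ from htc).trans ?_
          refine Set.iUnion₂_subset fun x hx => ?_
          exact subset_closure.trans
            (Set.subset_biUnion_of_mem (u := fun U => closure U) (Set.mem_image_of_mem B hx))
        · rintro _ ⟨x, hx, rfl⟩
          exact hB x (htK x hx)
        · change Disjoint _ _
          rw [Set.disjoint_iUnion₂_right]
          rintro _ ⟨x, hx, rfl⟩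
          exact hBA x (htK x hx)
      · have e : {A : YSpace P | ((A.1 : Set G) ∩ U).Nonempty} =
            ⋃₀ ((fun V : Set G => {A : YSpace P | ((A.1 : Set G) ∩ V).Nonempty}) ''
              {V ∈ countableBasis G | V ⊆ U}) := by
          ext A
          simp only [sUnion_image, mem_iUnion, mem_ofPred_eq, exists_prop]
          constructor
          · rintro ⟨x, hx, hxU⟩
            obtain ⟨V, hV, hxV, hVU⟩ := (isBasis_countableBasis G).exists_subset_of_mem_open
              hxU hU
            exact ⟨V, ⟨hV, hVU⟩, x, hx, hxV⟩
          · rintro ⟨V, ⟨-, hVU⟩, x, hx, hxV⟩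
            exact ⟨x, hx, hVU hxV⟩
        rw [e]
        refine @isOpen_sUnion _ (generateFrom 𝒮) _ ?_
        rintro _ ⟨V, ⟨hV, -⟩, rfl⟩
        exact isOpen_generateFrom_of_mem (Or.inr ⟨V, hV, rfl⟩)

variable [IsTopologicalAddGroup G]

/-- An ultrafilter converges to the set `L` of points all of whose neighbourhoods are hit along it.
Containing `p` keeps `L` non-empty and missing `O` keeps it different from `G`, so the limit stays
in `Y_u`. -/
theorem YSpace.isCompact_mem_disjoint (p : G) {O : Set G} (hO : IsOpen O) (hne : O.Nonempty) :
    IsCompact {A : YSpace P | p ∈ (A.1 : Set G) ∧ Disjoint (A.1 : Set G) O} := by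
  rw [isCompact_iff_ultrafilter_le_nhds]
  intro f hf
  rw [le_principal_iff] at hf
  let L : Set G := {x | ∀ U : Set G, IsOpen U → x ∈ U →
    {B : YSpace P | ((B.1 : Set G) ∩ U).Nonempty} ∈ f}
  have hL : IsClosed L := by
    rw [← isOpen_compl_iff, isOpen_iff_forall_mem_open]
    intro x hx
    simp only [L, mem_compl_iff, mem_ofPred_eq, not_forall] at hx
    obtain ⟨U, hU, hxU, hUf⟩ := hx
    exact ⟨U, fun y hy hyL => hUf (hyL U hU hy), hU, hxU⟩
  have hp : p ∈ L := fun U hU hpU => by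
    filter_upwards [hf] with B hB
    exact ⟨p, hB.1, hpU⟩
  have hLO : Disjoint L O := by
    rw [Set.disjoint_left]
    intro x hxL hxO
    obtain ⟨B, hB, hB'⟩ := f.nonempty_of_mem (inter_mem hf (hxL O hO hxO))
    exact hB'.ne_empty hB.2.inter_eq
  let A : YSpace P := ⟨⟨L, hL⟩, ⟨p, hp⟩, by
    intro a ha x hx U hU hxU
    filter_upwards [hx ((fun y => -a + y) ⁻¹' U) (hU.preimage (by fun_prop)) hxU] with B hB
    obtain ⟨y, hy, hyU⟩ := hB
    exact ⟨-a + y, B.2.2.1 a ha y hy, hyU⟩, by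
    intro h
    obtain ⟨x, hx⟩ := hne
    have hxL : x ∈ L := by
      change L = univ at h
      rw [h]
      trivial
    exact Set.disjoint_left.1 hLO hxL hx⟩
  refine ⟨A, ⟨hp, hLO⟩, ?_⟩
  rw [YSpace.topology_eq, nhds_generateFrom]
  simp only [le_iInf_iff, le_principal_iff]
  rintro S ⟨hAS, (⟨K, hK, rfl⟩ | ⟨U, hU, rfl⟩)⟩
  · have hx : ∀ x ∈ K, ∃ U : Set G, IsOpen U ∧ x ∈ U ∧
        {B : YSpace P | Disjoint (B.1 : Set G) U} ∈ f := by
      intro x hxK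
      have hxL : x ∉ L := fun h => Set.disjoint_left.1 hAS h hxK
      simp only [L, mem_ofPred_eq, not_forall] at hxL
      obtain ⟨U, hU, hxU, hUf⟩ := hxL
      refine ⟨U, hU, hxU, ?_⟩
      filter_upwards [Ultrafilter.compl_mem_iff_notMem.2 hUf] with B hB
      exact Set.disjoint_iff_inter_eq_empty.2 (Set.not_nonempty_iff_eq_empty.1 hB)
    choose! U hU hxU hUf using hx
    obtain ⟨t, htK⟩ := hK.elim_nhds_subcover' (fun x _ => U x)
      (fun x hx => (hU x hx).mem_nhds (hxU x hx))
    have : ∀ᶠ B : YSpace P in (f : Filter (YSpace P)), ∀ x ∈ t, Disjoint (B.1 : Set G) (U x) :=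
      (Finset.eventually_all t).2 fun x _ => hUf x x.2
    filter_upwards [this] with B hB
    refine Disjoint.mono_right htK ?_
    rw [Set.disjoint_iUnion₂_right]
    exact hB
  · obtain ⟨x, hx, hxU⟩ := hAS
    exact hx U hU hxU

variable [LocallyCompactSpace G]

theorem continuous_translate_uncurry :
    Continuous fun p : G × YSpace P => translate p.1 p.2 := by
  rw [YSpace.topology_eq, continuous_generateFrom_iff, ← YSpace.topology_eq]
  rintro S (⟨K, hK, rfl⟩ | ⟨U, hU, rfl⟩)
  · rw [isOpen_iff_forall_mem_open]
    rintro ⟨s, A⟩ hsA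
    have hK' : IsCompact ((fun x => x - s) '' K) := hK.image (by fun_prop)
    have hd : (fun x => x - s) '' K ⊆ (A.1 : Set G)ᶜ := by
      rintro _ ⟨x, hx, rfl⟩ hxA
      exact Set.disjoint_left.1 hsA hxA hx
    -- Thicken `K - s` by a compact neighbourhood `C` of `0` while still missing `A`; the margin
    -- absorbs small changes of `s`.
    obtain ⟨W, hW, hKW⟩ := compact_open_separated_add_right hK' A.1.isClosed.isOpen_compl hd
    obtain ⟨C, hC, hCW, hCc⟩ := local_compact_nhds hW
    refine ⟨((fun x => s - x) ⁻¹' interior C) ×ˢ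
      {B : YSpace P | Disjoint (B.1 : Set G) ((fun x => x - s) '' K + C)}, ?_, ?_, ?_⟩
    · rintro ⟨s', B⟩ ⟨hs', hB⟩
      change Disjoint _ _
      rw [Set.disjoint_left]
      intro x hx hxK
      exact Set.disjoint_left.1 hB hx ⟨x - s, ⟨x, hxK, rfl⟩, s - s', interior_subset hs', by simp⟩
    · exact (isOpen_interior.preimage (by fun_prop)).prod (YSpace.isOpen_miss (hK'.add hCc))
    · refine ⟨by simpa using mem_interior_iff_mem_nhds.2 hC, ?_⟩
      have : (fun x => x - s) '' K + C ⊆ (A.1 : Set G)ᶜ :=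
        (Set.add_subset_add_left hCW).trans hKW
      exact (Set.subset_compl_iff_disjoint_left.1 this)
  · rw [isOpen_iff_forall_mem_open]
    rintro ⟨s, A⟩ ⟨x, hx, hxU⟩
    have ho : IsOpen ((fun p : G × G => p.1 + p.2) ⁻¹' U) := hU.preimage continuous_add
    obtain ⟨V, W, hV, hW, hxV, hsW, hVW⟩ := isOpen_prod_iff.1 ho (x - s) s
      (by simpa using hxU)
    refine ⟨W ×ˢ {B : YSpace P | ((B.1 : Set G) ∩ V).Nonempty}, ?_, hW.prod (YSpace.isOpen_hit hV),
      hsW, x - s, hx, hxV⟩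
    rintro ⟨s', B⟩ ⟨hs', y, hy, hyV⟩
    refine ⟨y + s', ?_, hVW (Set.mk_mem_prod hyV hs')⟩
    change y + s' - s' ∈ (B.1 : Set G)
    rwa [add_sub_cancel_right]

end FellTopology

/-! ### Order units, finiteness on exhausting sets and σ-finiteness -/

section Exhaustion

variable {G : Type*} [AddCommGroup G] [TopologicalSpace G] {P : AddSubmonoid G}

/-- `a₀` is an order unit of `P`. -/
def IsOrderUnit (P : AddSubmonoid G) (a₀ : G) : Prop :=
  a₀ ∈ interior (P : Set G) ∧ ∀ s : G, ∃ n : ℕ, 0 < n ∧ n • a₀ - s ∈ interior (P : Set G)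

theorem IsOrderUnit.mem {a₀ : G} (h : IsOrderUnit P a₀) : a₀ ∈ P := interior_subset h.1

theorem IsOrderUnit.exists_forall_sub_mem {a₀ : G} (h : IsOrderUnit P a₀) (s : G) :
    ∃ N : ℕ, ∀ n ≥ N, n • a₀ - s ∈ P := by
  obtain ⟨N, -, hN⟩ := h.2 s
  refine ⟨N, fun n hn => ?_⟩
  obtain ⟨k, rfl⟩ := Nat.exists_eq_add_of_le hn
  have : (N + k) • a₀ - s = k • a₀ + (N • a₀ - s) := by rw [add_smul]; abel
  rw [this]
  exact P.add_mem (P.nsmul_mem h.mem k) (interior_subset hN)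

/-- The set of those `A` that contain `-n a₀` but not `n a₀`. -/
def exhaustion (P : AddSubmonoid G) (a₀ : G) (n : ℕ) : Set (YSpace P) :=
  {A | -(n • a₀) ∈ (A.1 : Set G) ∧ n • a₀ ∉ (A.1 : Set G)}

theorem measurableSet_exhaustion (a₀ : G) (n : ℕ) : MeasurableSet (exhaustion P a₀ n) :=
  (YSpace.measurableSet_mem _).inter (YSpace.measurableSet_mem _).compl

theorem IsOrderUnit.iUnion_exhaustion {a₀ : G} (h : IsOrderUnit P a₀) :
    ⋃ n, exhaustion P a₀ n = univ := by
  refine eq_univ_of_forall fun A => ?_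
  obtain ⟨x, hx⟩ := A.2.1
  obtain ⟨y, hy⟩ := (Set.ne_univ_iff_exists_notMem _).1 A.2.2.2
  obtain ⟨N, hN⟩ := h.exists_forall_sub_mem (-x)
  obtain ⟨M, hM⟩ := h.exists_forall_sub_mem y
  refine mem_iUnion.2 ⟨max N M, ?_, fun hmem => hy ?_⟩
  · have := A.sub_mem (hN (max N M) (le_max_left _ _)) hx
    convert this using 1
    abel
  · have := A.sub_mem (hM (max N M) (le_max_right _ _)) hmem
    convert this using 1
    abel

/-- If `A` misses `q`, heredity makes it miss the open set `q + Int(P)`, so the set lies in a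
compact one. -/
theorem measure_mem_notMem_lt_top [IsTopologicalAddGroup G] {μ : Measure (YSpace P)}
    [IsFiniteMeasureOnCompacts μ] (hP : (interior (P : Set G)).Nonempty) (p q : G) :
    μ {A | p ∈ (A.1 : Set G) ∧ q ∉ (A.1 : Set G)} < ∞ := by
  have ho : IsOpen ((fun x => x - q) ⁻¹' interior (P : Set G)) :=
    isOpen_interior.preimage (by fun_prop)
  refine (measure_mono ?_).trans_lt (YSpace.isCompact_mem_disjoint p ho ?_).measure_lt_top
  · rintro A ⟨hp, hq⟩
    refine ⟨hp, Set.disjoint_left.2 fun x hx hx' => hq ?_⟩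
    have := A.sub_mem (interior_subset hx') hx
    simpa using this
  · obtain ⟨x, hx⟩ := hP
    exact ⟨x + q, by simpa using hx⟩

theorem IsOrderUnit.measure_exhaustion_lt_top [IsTopologicalAddGroup G] {a₀ : G}
    (h : IsOrderUnit P a₀) (μ : Measure (YSpace P)) [IsFiniteMeasureOnCompacts μ] (n : ℕ) :
    μ (exhaustion P a₀ n) < ∞ :=
  measure_mem_notMem_lt_top ⟨_, h.1⟩ _ _

theorem IsOrderUnit.sigmaFinite [IsTopologicalAddGroup G] {a₀ : G}
    (h : IsOrderUnit P a₀) (μ : Measure (YSpace P)) [IsFiniteMeasureOnCompacts μ] :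
    SigmaFinite μ :=
  ⟨⟨{ set := exhaustion P a₀
      set_mem := fun _ => trivial
      finite := h.measure_exhaustion_lt_top μ
      spanning := h.iUnion_exhaustion }⟩⟩

end Exhaustion

/-! ### Ergodicity for almost invariant sets and functions -/

section Ergodicity

variable {G : Type*} [AddCommGroup G] [TopologicalSpace G] {P : AddSubmonoid G}
  [IsTopologicalAddGroup G]

theorem translate_neg_translate (s : G) (A : YSpace P) : translate (-s) (translate s A) = A := by
  rw [translate_translate, neg_add_cancel, translate_zero]

theorem translate_translate_neg (s : G) (A : YSpace P) : translate s (translate (-s) A) = A := by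
  rw [translate_translate, add_neg_cancel, translate_zero]

theorem IsConformalMeasure.quasiMeasurePreserving' {c : G →+ ℝ} {β : ℝ} {μ : Measure (YSpace P)}
    (hμ : IsConformalMeasure c β μ) (s : G) :
    Measure.QuasiMeasurePreserving (translate s) μ μ := by
  simpa using hμ.quasiMeasurePreserving (-s)

variable [LocallyCompactSpace G] [SecondCountableTopology G] [T2Space G]

/-- Ergodicity only concerns strictly invariant sets, and here the null set may depend on `s`. Let
`E'` consist of the `A` whose translates lie in `E` for Haar-almost every `s`: it is strictly
invariant by invariance of Haar measure, and by Fubini it agrees with `E` up to a null set. -/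
theorem IsErgodicMeasure.null_or_conull {μ : Measure (YSpace P)} [SFinite μ]
    (hμ : IsErgodicMeasure μ) {E : Set (YSpace P)} (hE : MeasurableSet E)
    (hinv : ∀ s : G, ∀ᵐ A ∂μ, translate s A ∈ E ↔ A ∈ E) : μ E = 0 ∨ μ Eᶜ = 0 := by
  borelize G
  have := YSpace.secondCountableTopology (P := P)
  let ρ : Measure G := Measure.addHaar
  have hmeas : Measurable fun p : YSpace P × G => translate p.2 p.1 :=
    (continuous_translate_uncurry.comp continuous_swap).measurable
  let E' : Set (YSpace P) := {A | ρ {s | translate s A ∉ E} = 0}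
  have hE' : MeasurableSet E' :=
    measurable_measure_prodMk_left (ν := ρ) (hmeas hE.compl) (measurableSet_singleton 0)
  have hae : ∀ᵐ A ∂μ, ∀ᵐ s ∂ρ, (translate s A ∈ E ↔ A ∈ E) := by
    refine (Measure.ae_ae_comm ?_).2 (ae_of_all _ hinv)
    have h1 : MeasurableSet {p : YSpace P × G | translate p.2 p.1 ∈ E} := hmeas hE
    have h2 : MeasurableSet {p : YSpace P × G | p.1 ∈ E} := measurable_fst hE
    exact h1.iff h2
  have hEE' : ∀ᵐ A ∂μ, A ∈ E' ↔ A ∈ E := by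
    filter_upwards [hae] with A hA
    constructor
    · intro h
      have h' : ∀ᵐ s ∂ρ, translate s A ∈ E := h
      obtain ⟨s, hs, hs'⟩ := (hA.and h').exists
      exact hs.1 hs'
    · intro h
      exact hA.mono fun s hs => hs.2 h
  have hsub : ∀ (r : G) (A : YSpace P), A ∈ E' → translate r A ∈ E' := by
    intro r A hA
    have e : {s | translate s (translate r A) ∉ E} = (fun s => s + r) ⁻¹' {s | translate s A ∉ E} := by
      ext s
      simp [translate_translate]
    change ρ _ = 0
    rw [e, measure_preimage_add_right]
    exact hA
  have hEm : ∀ s : G, translate s '' E' = E' := by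
    intro s
    rw [image_translate]
    ext A
    exact ⟨fun h => by simpa [translate_translate_neg] using hsub s _ h, fun h => hsub (-s) _ h⟩
  rcases hμ E' hE' hEm with h | h
  · left
    rw [measure_eq_zero_iff_ae_notMem] at h ⊢
    filter_upwards [h, hEE'] with A h1 h2
    rwa [← h2]
  · right
    rw [measure_eq_zero_iff_ae_notMem] at h ⊢
    filter_upwards [h, hEE'] with A h1 h2
    rwa [mem_compl_iff, ← h2]

theorem IsErgodicMeasure.exists_ae_eq_const {μ : Measure (YSpace P)} [SFinite μ]
    (hμ : IsErgodicMeasure μ) {X : Type*} [MeasurableSpace X] [Nonempty X]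
    [HasCountableSeparatingOn X MeasurableSet univ] {f : YSpace P → X} (hf : Measurable f)
    (hinv : ∀ s : G, ∀ᵐ A ∂μ, f (translate s A) = f A) : ∃ x, ∀ᵐ A ∂μ, f A = x := by
  refine exists_eventuallyEq_const_of_forall_separating MeasurableSet fun U hU => ?_
  have := hμ.null_or_conull (hf hU) fun s => by
    filter_upwards [hinv s] with A hA
    rw [mem_preimage, mem_preimage, hA]
  rcases this with h | h
  · right
    exact measure_eq_zero_iff_ae_notMem.1 h
  · left
    exact h

end Ergodicity

/-! ### Unitary equivalence and transport of conformality -/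

namespace IsometricSemigroup

variable {G : Type*} [AddCommGroup G] {P : AddSubmonoid G}
  {H : Type*} [NormedAddCommGroup H] [InnerProductSpace ℂ H]
  {K : Type*} [NormedAddCommGroup K] [InnerProductSpace ℂ K]
  {L : Type*} [NormedAddCommGroup L] [InnerProductSpace ℂ L]

theorem UnitarilyEquivalent.symm {V : IsometricSemigroup P H} {W : IsometricSemigroup P K}
    (h : V.UnitarilyEquivalent W) : W.UnitarilyEquivalent V := by
  obtain ⟨U, hU⟩ := h
  refine ⟨U.symm, fun a ξ => ?_⟩
  rw [LinearIsometryEquiv.symm_apply_eq, hU, LinearIsometryEquiv.apply_symm_apply]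

theorem UnitarilyEquivalent.trans {V : IsometricSemigroup P H} {W : IsometricSemigroup P K}
    {Z : IsometricSemigroup P L} (h : V.UnitarilyEquivalent W) (h' : W.UnitarilyEquivalent Z) :
    V.UnitarilyEquivalent Z := by
  obtain ⟨U, hU⟩ := h
  obtain ⟨U', hU'⟩ := h'
  exact ⟨U.trans U', fun a ξ => by simp [hU, hU']⟩

theorem UnitarilyEquivalent.twist {V : IsometricSemigroup P H} {W : IsometricSemigroup P K}
    (h : V.UnitarilyEquivalent W) (c : G →+ ℝ) (t : ℝ) :
    (V.twist c t).UnitarilyEquivalent (W.twist c t) := by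
  obtain ⟨U, hU⟩ := h
  exact ⟨U, fun a ξ => by rw [twist_op_apply, twist_op_apply, map_smul, hU]⟩

theorem adj_eq_zero_iff [CompleteSpace H] (V : IsometricSemigroup P H) (a : P) (ξ : H) :
    V.adj a ξ = 0 ↔ ∀ η : H, inner ℂ ξ (V.op a η) = 0 := by
  have h : ∀ η, inner ℂ (V.adj a ξ) η = inner ℂ ξ (V.op a η) := fun η => by
    rw [adj, ContinuousLinearMap.adjoint_inner_left]
    rfl
  simp_rw [← h]
  exact ⟨fun h0 η => by rw [h0, inner_zero_left], fun h0 => inner_self_eq_zero.1 (h0 _)⟩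

theorem IsConformal.of_unitarilyEquivalent [CompleteSpace H] [CompleteSpace K]
    {V : IsometricSemigroup P H} {W : IsometricSemigroup P K}
    (h : V.UnitarilyEquivalent W) {c : G →+ ℝ} {β : ℝ} (hV : V.IsConformal c β) :
    W.IsConformal c β := by
  obtain ⟨U, hU⟩ := h.symm
  have hadj : ∀ (a : P) (ξ : K), W.adj a ξ = 0 → V.adj a (U ξ) = 0 := by
    intro a ξ hξ
    rw [adj_eq_zero_iff] at hξ ⊢
    intro η
    obtain ⟨ζ, rfl⟩ := U.surjective η
    rw [← hU, U.inner_map_map]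
    exact hξ ζ
  have hadj' : ∀ (a : P) (ξ : H), V.adj a ξ = 0 → W.adj a (U.symm ξ) = 0 := by
    intro a ξ hξ
    rw [adj_eq_zero_iff] at hξ ⊢
    intro η
    rw [← U.inner_map_map, U.apply_symm_apply, hU]
    exact hξ _
  let T : W.domain →ₗ[ℂ] V.domain :=
    (U.toLinearEquiv.toLinearMap.domRestrict W.domain).codRestrict V.domain fun ξ => by
      obtain ⟨a, ha⟩ := ξ.2
      exact ⟨a, hadj a _ ha⟩
  have hT : ∀ ξ : W.domain, (T ξ : H) = U ξ := fun ξ => rfl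
  obtain ⟨φ, hφ, hne, hc⟩ := hV
  refine ⟨φ ∘ₗ T, ?_, ?_, ?_⟩
  · intro a
    obtain ⟨C, hC⟩ := hφ a
    refine ⟨C, fun ξ hξ => ?_⟩
    have := hC (T ξ) (hadj a _ hξ)
    rwa [hT, U.norm_map] at this
  · intro h0
    refine hne (LinearMap.ext fun ξ => ?_)
    obtain ⟨a, ha⟩ := ξ.2
    have hmem : U.symm ξ ∈ W.domain := ⟨a, hadj' a _ ha⟩
    have h1 : T ⟨U.symm ξ, hmem⟩ = ξ := Subtype.ext (by simp [hT])
    have := LinearMap.congr_fun h0 ⟨U.symm ξ, hmem⟩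
    rwa [LinearMap.comp_apply, h1] at this
  · intro a
    refine LinearMap.ext fun ξ => ?_
    have h1 : T (W.opDomain a ξ) = V.opDomain a (T ξ) := Subtype.ext (hU a ξ)
    have := LinearMap.congr_fun (hc a) (T ξ)
    rw [LinearMap.comp_apply, LinearMap.comp_apply, h1]
    exact this

end IsometricSemigroup

/-! ### Multiplication and cut-off operators on `L²` -/

section Multiplication

variable {α : Type*} [MeasurableSpace α] {μ : Measure α}

theorem memLp_mul_of_norm_le_one {m : α → ℂ} (hm : Measurable m) (hb : ∀ x, ‖m x‖ ≤ 1)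
    (f : Lp ℂ 2 μ) : MemLp (fun x => m x * f x) 2 μ :=
  (Lp.memLp f).of_le (hm.aestronglyMeasurable.mul (Lp.memLp f).1) (ae_of_all _ fun x => by
    rw [norm_mul]
    exact mul_le_of_le_one_left (norm_nonneg _) (hb x))

/-- Multiplication by a measurable function bounded by `1` on `L²`. -/
noncomputable def mulLp (μ : Measure α) (m : α → ℂ) (hm : Measurable m) (hb : ∀ x, ‖m x‖ ≤ 1) :
    Lp ℂ 2 μ →L[ℂ] Lp ℂ 2 μ :=
  have hmem := memLp_mul_of_norm_le_one hm hb
  LinearMap.mkContinuous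
    { toFun := fun f => (hmem f).toLp _
      map_add' := fun f g => by
        rw [← MemLp.toLp_add]
        refine (MemLp.toLp_eq_toLp_iff _ _).2 ?_
        filter_upwards [Lp.coeFn_add f g] with x hx
        simp only [hx, Pi.add_apply, mul_add]
      map_smul' := fun z f => by
        rw [RingHom.id_apply, ← MemLp.toLp_const_smul]
        refine (MemLp.toLp_eq_toLp_iff _ _).2 ?_
        filter_upwards [Lp.coeFn_smul z f] with x hx
        simp only [hx, Pi.smul_apply, smul_eq_mul]
        ring } 1 fun f => by
    rw [one_mul]
    refine Lp.norm_le_norm_of_ae_le ?_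
    filter_upwards [(hmem f).coeFn_toLp] with x hx
    refine (congrArg norm hx).trans_le ?_
    rw [norm_mul]
    exact mul_le_of_le_one_left (norm_nonneg _) (hb x)

theorem mulLp_coeFn {m : α → ℂ} (hm : Measurable m) (hb : ∀ x, ‖m x‖ ≤ 1) (f : Lp ℂ 2 μ) :
    mulLp μ m hm hb f =ᵐ[μ] fun x => m x * f x :=
  MemLp.coeFn_toLp (memLp_mul_of_norm_le_one hm hb f)

/-- Multiplication by the indicator function of a set on `L²`. -/
noncomputable def cutLp (μ : Measure α) (S : Set α) (hS : MeasurableSet S) :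
    Lp ℂ 2 μ →L[ℂ] Lp ℂ 2 μ :=
  mulLp μ (S.indicator 1) (measurable_one.indicator hS) fun x => by
    by_cases h : x ∈ S <;> simp [h]

theorem cutLp_coeFn {S : Set α} (hS : MeasurableSet S) (f : Lp ℂ 2 μ) :
    cutLp μ S hS f =ᵐ[μ] S.indicator f := by
  filter_upwards [mulLp_coeFn (measurable_one.indicator hS) (fun x => by
    by_cases h : x ∈ S <;> simp [h]) f] with x hx
  refine hx.trans ?_
  by_cases h : x ∈ S <;> simp [h]

theorem norm_cutLp_le {S : Set α} (hS : MeasurableSet S) (f : Lp ℂ 2 μ) :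
    ‖cutLp μ S hS f‖ ≤ ‖f‖ := by
  refine Lp.norm_le_norm_of_ae_le ?_
  filter_upwards [cutLp_coeFn hS f] with x hx
  rw [hx]
  exact norm_indicator_le_norm_self _ _

theorem inner_cutLp_left {S : Set α} (hS : MeasurableSet S) (f g : Lp ℂ 2 μ) :
    inner ℂ (cutLp μ S hS f) g = inner ℂ f (cutLp μ S hS g) := by
  rw [L2.inner_def, L2.inner_def]
  refine integral_congr_ae ?_
  filter_upwards [cutLp_coeFn hS f, cutLp_coeFn hS g] with x hf hg
  rw [hf, hg]
  by_cases h : x ∈ S <;> simp [h]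

theorem cutLp_eq_self {S : Set α} (hS : MeasurableSet S) {f : Lp ℂ 2 μ}
    (hf : ∀ᵐ x ∂μ, x ∉ S → f x = 0) : cutLp μ S hS f = f := by
  refine Lp.ext ?_
  filter_upwards [cutLp_coeFn hS f, hf] with x hx h
  rw [hx]
  by_cases hxS : x ∈ S <;> simp [hxS]
  exact (h hxS).symm

theorem cutLp_eq_zero_iff {S : Set α} (hS : MeasurableSet S) {f : Lp ℂ 2 μ} :
    cutLp μ S hS f = 0 ↔ ∀ᵐ x ∂μ, x ∈ S → f x = 0 := by
  rw [Lp.eq_zero_iff_ae_eq_zero]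
  constructor
  · intro h
    filter_upwards [h, cutLp_coeFn hS f] with x h1 h2 hx
    rwa [h1, Pi.zero_apply, Set.indicator_of_mem hx, eq_comm] at h2
  · intro h
    filter_upwards [h, cutLp_coeFn hS f] with x h1 h2
    rw [h2]
    by_cases hxS : x ∈ S <;> simp [hxS]
    exact h1 hxS

end Multiplication

/-! ### Kernels of the adjoints of `V^μ` and equivalence with the twists -/

section SemigroupOfMeasure

variable {G : Type*} [AddCommGroup G] [TopologicalSpace G] [IsTopologicalAddGroup G]
  {P : AddSubmonoid G} {c : G →+ ℝ} {β : ℝ} {μ : Measure (YSpace P)}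

theorem measurableSet_XSet : MeasurableSet (XSet P) := YSpace.measurableSet_mem 0

theorem mem_L2X_iff {f : Lp ℂ 2 μ} : f ∈ L2X μ ↔ cutLp μ (XSet P)ᶜ measurableSet_XSet.compl f = 0 := by
  rw [cutLp_eq_zero_iff]
  rfl

instance : CompleteSpace (L2X μ) := by
  have h : IsClosed (L2X μ : Set (Lp ℂ 2 μ)) := by
    have e : (L2X μ : Set (Lp ℂ 2 μ)) = cutLp μ (XSet P)ᶜ measurableSet_XSet.compl ⁻¹' {0} := by
      ext f
      exact mem_L2X_iff
    rw [e]
    exact isClosed_singleton.preimage (ContinuousLinearMap.continuous _)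
  exact h.completeSpace_coe

theorem translate_neg_mem_XSet {a : G} {A : YSpace P} :
    translate (-a) A ∈ XSet P ↔ a ∈ (A.1 : Set G) := by
  change (0 : G) - -a ∈ (A.1 : Set G) ↔ _
  rw [zero_sub, neg_neg]

theorem semigroupOfMeasure_op_coe (hμ : IsConformalMeasure c β μ) (a : P) (f : L2X μ) :
    ((semigroupOfMeasure hμ).op a f : Lp ℂ 2 μ) = koopman hμ (a : G) f := rfl

theorem koopman_neg_koopman (hμ : IsConformalMeasure c β μ) (s : G) (f : Lp ℂ 2 μ) :
    koopman hμ (-s) (koopman hμ s f) = f := by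
  rw [← koopman_add, neg_add_cancel, koopman_zero]

theorem koopman_koopman_neg (hμ : IsConformalMeasure c β μ) (s : G) (f : Lp ℂ 2 μ) :
    koopman hμ s (koopman hμ (-s) f) = f := by
  rw [← koopman_add, add_neg_cancel, koopman_zero]

/-- The range of `V^μ_a` consists of the `L²` functions supported on `X_u + a = {A : a ∈ A}`, and
the kernel of the adjoint is its orthogonal complement. -/
theorem semigroupOfMeasure_adj_eq_zero_iff (hμ : IsConformalMeasure c β μ) (a : P) (f : L2X μ) :
    (semigroupOfMeasure hμ).adj a f = 0 ↔
      ∀ᵐ A ∂μ, (a : G) ∈ (A.1 : Set G) → (f : Lp ℂ 2 μ) A = 0 := by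
  rw [IsometricSemigroup.adj_eq_zero_iff]
  have hS := YSpace.measurableSet_mem (P := P) (a : G)
  constructor
  · intro h
    -- The part of `f` on `{A : a ∈ A}` is `V^μ_a` of this vector, so orthogonality makes its norm
    -- vanish.
    have hg : koopman hμ (-(a : G)) (cutLp μ _ hS f) ∈ L2X μ := by
      change ∀ᵐ A ∂μ, _
      filter_upwards [koopman_coeFn hμ (-(a : G)) (cutLp μ _ hS f),
        hμ.koopmanFun_congr (-(a : G)) (cutLp_coeFn hS (f : Lp ℂ 2 μ))] with A h1 h2 hA
      rw [h1, h2, koopmanFun, Set.indicator_of_notMem, mul_zero]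
      rw [neg_neg]
      intro h'
      refine hA ?_
      have h'' : (a : G) - a ∈ (A.1 : Set G) := h'
      rwa [sub_self] at h''
    have := h ⟨_, hg⟩
    rw [Submodule.coe_inner, semigroupOfMeasure_op_coe, koopman_koopman_neg] at this
    refine (cutLp_eq_zero_iff hS).1 ?_
    rw [← inner_self_eq_zero (𝕜 := ℂ), inner_cutLp_left]
    rw [cutLp_eq_self hS (f := cutLp μ _ hS f)]
    · exact this
    · filter_upwards [cutLp_coeFn hS (f : Lp ℂ 2 μ)] with A hA hA'
      exact hA.trans (Set.indicator_of_notMem (s := {A : YSpace P | (a : G) ∈ (A.1 : Set G)}) hA' _)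
  · intro h g
    have hg : ∀ᵐ A ∂μ, A ∉ XSet P → (g : Lp ℂ 2 μ) A = 0 := g.2
    rw [Submodule.coe_inner, semigroupOfMeasure_op_coe, L2.inner_def]
    refine integral_eq_zero_of_ae ?_
    filter_upwards [h, koopman_coeFn hμ (a : G) g, (hμ.quasiMeasurePreserving (a : G)).ae hg]
      with A h1 h2 h3
    by_cases hA : (a : G) ∈ (A.1 : Set G)
    · simp [h1 hA]
    · rw [h2, koopmanFun, h3 fun h => hA (translate_neg_mem_XSet.1 h)]
      simp

theorem twist_adj_eq_zero_iff {G : Type*} [AddCommGroup G] {P : AddSubmonoid G} {H : Type*}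
    [NormedAddCommGroup H] [InnerProductSpace ℂ H] [CompleteSpace H]
    (V : IsometricSemigroup P H) (c : G →+ ℝ) (t : ℝ) (a : P) (ξ : H) :
    (V.twist c t).adj a ξ = 0 ↔ V.adj a ξ = 0 := by
  simp only [IsometricSemigroup.adj_eq_zero_iff, IsometricSemigroup.twist_op_apply,
    inner_smul_right, mul_eq_zero, Complex.exp_ne_zero, false_or]

/-- Multiplication by `e^{itF}` is unitary and preserves supports; moving it past a translation by
`a` produces the scalar `e^{itc(a)}`. -/
theorem unitarilyEquivalent_twist_of_translate_eq_add (hμ : IsConformalMeasure c β μ)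
    {F : YSpace P → ℝ} (hF : Measurable F)
    (hFc : ∀ s : G, ∀ᵐ A ∂μ, F (translate s A) = F A + c s) (t : ℝ) :
    (semigroupOfMeasure hμ).UnitarilyEquivalent ((semigroupOfMeasure hμ).twist c t) := by
  let e : ℝ → YSpace P → ℂ := fun r A => Complex.exp ((r * F A : ℝ) * Complex.I)
  have hem : ∀ r, Measurable (e r) := fun r => by fun_prop
  have heb : ∀ r A, ‖e r A‖ ≤ 1 := fun r A => (Complex.norm_exp_ofReal_mul_I _).le
  let M : ℝ → Lp ℂ 2 μ →L[ℂ] Lp ℂ 2 μ := fun r => mulLp μ (e r) (hem r) (heb r)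
  have hM : ∀ r f, M r f =ᵐ[μ] fun A => e r A * f A := fun r f => mulLp_coeFn _ _ f
  have hMX : ∀ r, ∀ f ∈ L2X μ, M r f ∈ L2X μ := by
    intro r f hf
    have hf' : ∀ᵐ A ∂μ, A ∉ XSet P → f A = 0 := hf
    change ∀ᵐ A ∂μ, A ∉ XSet P → M r f A = 0
    filter_upwards [hf', hM r f] with A h1 h2 hA
    rw [h2, h1 hA, mul_zero]
  have hinv : ∀ r f, M r (M (-r) f) = f := by
    intro r f
    refine Lp.ext ?_
    filter_upwards [hM r (M (-r) f), hM (-r) f] with A h1 h2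
    rw [h1, h2, ← mul_assoc, ← Complex.exp_add]
    simp
  have hnorm : ∀ r f, ‖M r f‖ = ‖f‖ := by
    intro r f
    rw [Lp.norm_def, Lp.norm_def]
    congr 1
    refine eLpNorm_congr_norm_ae ?_
    filter_upwards [hM r f] with A h1
    rw [h1, norm_mul, Complex.norm_exp_ofReal_mul_I, one_mul]
  let U₀ : L2X μ →ₗᵢ[ℂ] L2X μ :=
    { toLinearMap := (M t).toLinearMap.restrict (hMX t)
      norm_map' := fun f => hnorm t f }
  have hU₀ : Function.Surjective U₀ := fun f =>
    ⟨⟨M (-t) f, hMX _ _ f.2⟩, Subtype.ext (hinv t f)⟩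
  let U : L2X μ ≃ₗᵢ[ℂ] L2X μ := LinearIsometryEquiv.ofSurjective U₀ hU₀
  refine ⟨U, fun a f => Subtype.ext ?_⟩
  have hU : ∀ f, (U f : Lp ℂ 2 μ) = M t f := fun f => rfl
  rw [hU, IsometricSemigroup.twist_op_apply, Submodule.coe_smul, semigroupOfMeasure_op_coe,
    semigroupOfMeasure_op_coe, hU]
  refine Lp.ext ?_
  filter_upwards [hM t (koopman hμ (a : G) f), koopman_coeFn hμ (a : G) (f : Lp ℂ 2 μ),
    Lp.coeFn_smul (Complex.exp (Complex.I * (t * c (a : G) : ℝ))) (koopman hμ (a : G) (M t f)),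
    koopman_coeFn hμ (a : G) (M t f), hμ.koopmanFun_congr (a : G) (hM t f), hFc (-(a : G))]
    with A h1 h2 h3 h4 h5 h6
  rw [h1, h2, h3, Pi.smul_apply, h4, h5]
  simp only [koopmanFun, smul_eq_mul, e]
  have hexp : Complex.exp ((t * F A : ℝ) * Complex.I) = Complex.exp (Complex.I * (t * c (a : G) : ℝ)) *
      Complex.exp ((t * F (translate (-(a : G)) A) : ℝ) * Complex.I) := by
    rw [← Complex.exp_add, h6, map_neg]
    congr 1
    push_cast
    ring
  rw [hexp]
  ring

end SemigroupOfMeasure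

/-! ### Invariant measures and densities transforming by `e^{βc}` -/

section InvariantMeasure

variable {G : Type*} [AddCommGroup G] [TopologicalSpace G] [IsTopologicalAddGroup G]
  {P : AddSubmonoid G} {c : G →+ ℝ} {β : ℝ} {μ : Measure (YSpace P)}

theorem IsConformalMeasure.lintegral_translate (hμ : IsConformalMeasure c β μ) (s : G)
    {f : YSpace P → ℝ≥0∞} (hf : Measurable f) :
    ∫⁻ A, f (translate s A) ∂μ = ENNReal.ofReal (Real.exp (β * c s)) * ∫⁻ A, f A ∂μ := by
  rw [← lintegral_map hf (measurable_translate s)]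
  have h := hμ.map_translate (-s)
  rw [neg_neg, map_neg, neg_mul_neg] at h
  rw [h, lintegral_smul_measure, smul_eq_mul]

theorem IsConformalMeasure.withDensity_image_translate (hμ : IsConformalMeasure c β μ) (s : G)
    {h : YSpace P → ℝ≥0∞} (hh : Measurable h) {E : Set (YSpace P)} (hE : MeasurableSet E) :
    μ.withDensity h (translate s '' E) =
      μ.withDensity (fun A => ENNReal.ofReal (Real.exp (-(β * c s))) * h (translate s A)) E := by
  have hE' : MeasurableSet (translate s '' E) := by
    rw [image_translate]
    exact measurable_translate _ hE
  rw [withDensity_apply _ hE', withDensity_apply _ hE, lintegral_const_mul' _ _ (by simp),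
    ← lintegral_indicator hE', ← lintegral_indicator hE]
  have e : (E.indicator fun A => h (translate s A)) =
      fun A => (translate s '' E).indicator h (translate s A) := by
    ext A
    have : translate s A ∈ translate s '' E ↔ A ∈ E := by
      rw [image_translate, mem_preimage, translate_neg_translate]
    by_cases hA : A ∈ E
    · rw [indicator_of_mem hA, indicator_of_mem (this.2 hA)]
    · rw [indicator_of_notMem hA, indicator_of_notMem (mt this.1 hA)]
  rw [e, hμ.lintegral_translate s (hh.indicator hE'), ← mul_assoc,
    ← ENNReal.ofReal_mul (Real.exp_pos _).le, ← Real.exp_add, neg_add_cancel, Real.exp_zero,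
    ENNReal.ofReal_one, one_mul]

theorem IsConformalMeasure.isInvariantMeasure_withDensity (hμ : IsConformalMeasure c β μ)
    {h : YSpace P → ℝ≥0∞} (hh : Measurable h)
    (hs : ∀ s : G, ∀ᵐ A ∂μ, h (translate s A) = ENNReal.ofReal (Real.exp (β * c s)) * h A) :
    IsInvariantMeasure (μ.withDensity h) := by
  intro s E hE
  rw [hμ.withDensity_image_translate s hh hE]
  congr 1
  refine withDensity_congr_ae ?_
  filter_upwards [hs s] with A hA
  rw [hA, ← mul_assoc, ← ENNReal.ofReal_mul (Real.exp_pos _).le, ← Real.exp_add, neg_add_cancel,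
    Real.exp_zero, ENNReal.ofReal_one, one_mul]

/-- Invariance of `ν` and conformality of `μ` force `h(A + s) = e^{βc(s)} h(A)` for `h = dν/dμ`, by
uniqueness of densities. Equivalence of the measures makes `h` positive and finite almost
everywhere, so `F = (log h)/β` works. -/
theorem IsConformalMeasure.exists_translate_eq_add [SigmaFinite μ] (hμ : IsConformalMeasure c β μ)
    (hβ : β ≠ 0) {ν : Measure (YSpace P)} [SigmaFinite ν] (hν : IsInvariantMeasure ν)
    (hνμ : ν ≪ μ) (hμν : μ ≪ ν) :
    ∃ F : YSpace P → ℝ, Measurable F ∧ ∀ s : G, ∀ᵐ A ∂μ, F (translate s A) = F A + c s := by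
  have hh : Measurable (ν.rnDeriv μ) := ν.measurable_rnDeriv μ
  have hd : μ.withDensity (ν.rnDeriv μ) = ν := Measure.withDensity_rnDeriv_eq ν μ hνμ
  have hpos := Measure.rnDeriv_pos' (ν := ν) (μ := μ) hμν
  have hfin := ν.rnDeriv_lt_top μ
  refine ⟨fun A => Real.log (ν.rnDeriv μ A).toReal / β,
    (Real.measurable_log.comp hh.ennreal_toReal).div_const β, fun s => ?_⟩
  have hk : Measurable fun A =>
      ENNReal.ofReal (Real.exp (-(β * c s))) * ν.rnDeriv μ (translate s A) :=
    (hh.comp (measurable_translate s)).const_mul _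
  have heq : μ.withDensity (fun A =>
      ENNReal.ofReal (Real.exp (-(β * c s))) * ν.rnDeriv μ (translate s A)) =
      μ.withDensity (ν.rnDeriv μ) := by
    ext E hE
    rw [← hμ.withDensity_image_translate s hh hE, hd, hν s E hE]
  rw [withDensity_eq_iff_of_sigmaFinite hk.aemeasurable hh.aemeasurable] at heq
  filter_upwards [heq, hpos, hfin] with A h1 h2 h3
  have h4 : (ν.rnDeriv μ A).toReal =
      Real.exp (-(β * c s)) * (ν.rnDeriv μ (translate s A)).toReal := by
    rw [← h1, ENNReal.toReal_mul, ENNReal.toReal_ofReal (Real.exp_pos _).le]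
  have h5 : (ν.rnDeriv μ A).toReal ≠ 0 := (ENNReal.toReal_pos h2.ne' h3.ne).ne'
  have h6 : (ν.rnDeriv μ (translate s A)).toReal ≠ 0 := fun h => h5 (by rw [h4, h, mul_zero])
  rw [h4, Real.log_mul (Real.exp_ne_zero _) h6, Real.log_exp]
  field_simp
  ring

end InvariantMeasure

/-! ### Conformality of `V^μ` itself -/

section ConformalSemigroup

variable {G : Type*} [AddCommGroup G] [TopologicalSpace G] [IsTopologicalAddGroup G]
  {P : AddSubmonoid G} {c : G →+ ℝ} {β : ℝ} {μ : Measure (YSpace P)}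

/-- The complement of `X_u + a` in `X_u`. -/
def XDiff (P : AddSubmonoid G) (a : G) : Set (YSpace P) :=
  {A | (0 : G) ∈ (A.1 : Set G) ∧ a ∉ (A.1 : Set G)}

theorem measurableSet_XDiff (a : G) : MeasurableSet (XDiff P a) :=
  (YSpace.measurableSet_mem _).inter (YSpace.measurableSet_mem _).compl

theorem ae_eq_zero_of_notMem_XDiff {a : G} {f : Lp ℂ 2 μ} (hf : f ∈ L2X μ)
    (ha : ∀ᵐ A ∂μ, a ∈ (A.1 : Set G) → f A = 0) : ∀ᵐ A ∂μ, A ∉ XDiff P a → f A = 0 := by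
  have hf' : ∀ᵐ A ∂μ, A ∉ XSet P → f A = 0 := hf
  filter_upwards [hf', ha] with A h1 h2 hA
  by_cases h0 : A ∈ XSet P
  · by_cases h3 : a ∈ (A.1 : Set G)
    · exact h2 h3
    · exact absurd ⟨h0, h3⟩ hA
  · exact h1 h0

theorem integrable_of_ae_eq_zero {α : Type*} [MeasurableSpace α] {μ : Measure α} {S : Set α}
    (hSμ : μ S ≠ ∞) {f : Lp ℂ 2 μ} (hf : ∀ᵐ x ∂μ, x ∉ S → f x = 0) : Integrable f μ := by
  have : IsFiniteMeasure (μ.restrict S) := ⟨by simpa using hSμ.lt_top⟩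
  have h : IntegrableOn f S μ := ((Lp.memLp f).restrict S).integrable one_le_two
  exact h.integrable_of_ae_notMem_eq_zero hf

theorem integral_eq_inner_of_ae_eq_zero {α : Type*} [MeasurableSpace α] {μ : Measure α} {S : Set α}
    (hS : MeasurableSet S) (hSμ : μ S ≠ ∞) {f : Lp ℂ 2 μ} (hf : ∀ᵐ x ∂μ, x ∉ S → f x = 0) :
    ∫ x, f x ∂μ = inner ℂ (indicatorConstLp 2 hS hSμ (1 : ℂ)) f := by
  rw [L2.inner_indicatorConstLp_one, setIntegral_eq_integral_of_ae_compl_eq_zero hf]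

theorem IsConformalMeasure.integral_koopman (hμ : IsConformalMeasure c β μ) (s : G)
    (f : Lp ℂ 2 μ) :
    ∫ A, koopman hμ s f A ∂μ = (Real.exp (-(β * c s) / 2) : ℂ) * ∫ A, f A ∂μ := by
  rw [integral_congr_ae (koopman_coeFn hμ s f)]
  simp only [koopmanFun]
  rw [integral_const_mul]
  have h : ∫ A, f (translate (-s) A) ∂μ = (Real.exp (-β * c s) : ℂ) * ∫ A, f A ∂μ := by
    rw [← integral_map (f := f) (measurable_translate (-s)).aemeasurable, hμ.map_translate,
      integral_smul_measure, ENNReal.toReal_ofReal (Real.exp_pos _).le, Complex.real_smul]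
    rw [hμ.map_translate]
    exact (Lp.memLp f).1.smul_measure _
  rw [h, ← mul_assoc, ← Complex.ofReal_mul, ← Real.exp_add]
  congr 4
  ring

/-- The functional is `f ↦ ∫ f dμ`. Elements of the kernel of the adjoint at `a` are supported on
`X_u \ (X_u + a)`, which has finite measure, so Cauchy–Schwarz gives boundedness there. -/
theorem IsConformalMeasure.isConformal_semigroupOfMeasure [IsFiniteMeasureOnCompacts μ]
    (hμ : IsConformalMeasure c β μ) (hμ0 : μ ≠ 0) {a₀ : G} (ha₀ : IsOrderUnit P a₀) :
    (semigroupOfMeasure hμ).IsConformal c β := by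
  have hfin : ∀ a : G, μ (XDiff P a) ≠ ∞ := fun a =>
    (measure_mem_notMem_lt_top ⟨_, ha₀.1⟩ 0 a).ne
  have hdom : ∀ f : (semigroupOfMeasure hμ).domain, ∃ a : P,
      ∀ᵐ A ∂μ, A ∉ XDiff P (a : G) → ((f : L2X μ) : Lp ℂ 2 μ) A = 0 := by
    intro f
    obtain ⟨a, ha⟩ := f.2
    exact ⟨a, ae_eq_zero_of_notMem_XDiff f.1.2
      ((semigroupOfMeasure_adj_eq_zero_iff hμ a f).1 ha)⟩
  have hint : ∀ f : (semigroupOfMeasure hμ).domain,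
      Integrable ((f : L2X μ) : Lp ℂ 2 μ) μ := by
    intro f
    obtain ⟨a, ha⟩ := hdom f
    exact integrable_of_ae_eq_zero (hfin a) ha
  let φ : (semigroupOfMeasure hμ).domain →ₗ[ℂ] ℂ :=
    { toFun := fun f => ∫ A, ((f : L2X μ) : Lp ℂ 2 μ) A ∂μ
      map_add' := fun f g => by
        rw [← integral_add (hint f) (hint g)]
        exact integral_congr_ae (Lp.coeFn_add _ _)
      map_smul' := fun z f => by
        rw [RingHom.id_apply, ← integral_smul]
        exact integral_congr_ae (Lp.coeFn_smul _ _) }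
  refine ⟨φ, fun a => ?_, fun h0 => ?_, fun a => LinearMap.ext fun f => ?_⟩
  · refine ⟨‖indicatorConstLp 2 (measurableSet_XDiff (P := P) (a : G)) (hfin a) (1 : ℂ)‖,
      fun f hf => ?_⟩
    change ‖∫ A, ((f : L2X μ) : Lp ℂ 2 μ) A ∂μ‖ ≤ _
    rw [integral_eq_inner_of_ae_eq_zero (measurableSet_XDiff (P := P) (a : G)) (hfin a)
      (ae_eq_zero_of_notMem_XDiff f.1.2 ((semigroupOfMeasure_adj_eq_zero_iff hμ a f).1 hf))]
    exact norm_inner_le_norm _ _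
  -- Non-vanishing: some exhausting set has positive measure, and its translate by `n a₀` is `X_u \
  -- (X_u + 2n a₀)`, whose indicator lies in the domain.
  · obtain ⟨n, hn⟩ : ∃ n, μ (exhaustion P a₀ n) ≠ 0 := by
      by_contra! h
      refine hμ0 (Measure.measure_univ_eq_zero.1 ?_)
      rw [← ha₀.iUnion_exhaustion]
      exact measure_iUnion_null h
    have himg : translate (n • a₀) '' exhaustion P a₀ n = XDiff P (n • a₀ + n • a₀) := by
      rw [image_translate]
      ext A
      change (-(n • a₀) - -(n • a₀) ∈ (A.1 : Set G) ∧ ¬ (n • a₀ - -(n • a₀) ∈ (A.1 : Set G))) ↔ _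
      rw [sub_self, sub_neg_eq_add]
      rfl
    have hpos : μ (XDiff P (n • a₀ + n • a₀)) ≠ 0 := by
      rw [← himg, hμ _ _ (measurableSet_exhaustion a₀ n)]
      exact mul_ne_zero (by simpa using Real.exp_pos _) hn
    let a : P := ⟨n • a₀ + n • a₀, P.add_mem (P.nsmul_mem ha₀.mem n) (P.nsmul_mem ha₀.mem n)⟩
    let f : Lp ℂ 2 μ := indicatorConstLp 2 (measurableSet_XDiff (P := P) (a : G)) (hfin a) (1 : ℂ)
    have hfX : f ∈ L2X μ := by
      change ∀ᵐ A ∂μ, _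
      filter_upwards [indicatorConstLp_coeFn_notMem (p := 2) (c := (1 : ℂ))
        (hs := measurableSet_XDiff (P := P) (a : G)) (hμs := hfin a)] with A hA hA'
      exact hA fun h => hA' h.1
    have hfd : (⟨f, hfX⟩ : L2X μ) ∈ (semigroupOfMeasure hμ).domain := by
      refine ⟨a, (semigroupOfMeasure_adj_eq_zero_iff hμ a _).2 ?_⟩
      filter_upwards [indicatorConstLp_coeFn_notMem (p := 2) (c := (1 : ℂ))
        (hs := measurableSet_XDiff (P := P) (a : G)) (hμs := hfin a)] with A hA hA'
      exact hA fun h => h.2 hA'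
    have h1 : ∫ A, f A ∂μ = 0 := LinearMap.congr_fun h0 ⟨⟨f, hfX⟩, hfd⟩
    rw [integral_indicatorConstLp, Complex.real_smul, mul_one, Complex.ofReal_eq_zero,
      measureReal_eq_zero_iff (hfin a)] at h1
    exact hpos h1
  · exact hμ.integral_koopman a _

end ConformalSemigroup

/-! ### From conformal functionals to eigenfunctions -/

section Eigenfunctions

variable {G : Type*} [AddCommGroup G] [TopologicalSpace G] [IsTopologicalAddGroup G]
  {P : AddSubmonoid G} {c : G →+ ℝ} {β : ℝ} {μ : Measure (YSpace P)}

/-- `u(A + s) = e^{itc(s)} u(A)` for all `s` and almost all `A`. -/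
def IsEigenfunction (μ : Measure (YSpace P)) (c : G →+ ℝ) (t : ℝ) (u : YSpace P → ℂ) : Prop :=
  ∀ s : G, ∀ᵐ A ∂μ, u (translate s A) = Complex.exp (Complex.I * (t * c s : ℝ)) * u A

/-- The functions in `L²(X_u, μ)` that vanish outside `X_u \ (X_u + a)` for some `a ∈ P`. -/
def MemDomain (f : Lp ℂ 2 μ) : Prop :=
  f ∈ L2X μ ∧ ∃ a ∈ P, ∀ᵐ A ∂μ, a ∈ (A.1 : Set G) → f A = 0

theorem MemDomain.koopman {f : Lp ℂ 2 μ} (hf : MemDomain f) (hμ : IsConformalMeasure c β μ) {b : G}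
    (hb : b ∈ P) : MemDomain (koopman hμ b f) := by
  obtain ⟨hf, a, ha, h⟩ := hf
  refine ⟨koopman_mem_L2X hμ hb hf, b + a, P.add_mem hb ha, ?_⟩
  filter_upwards [koopman_coeFn hμ b f, (hμ.quasiMeasurePreserving b).ae h] with A h1 h2 hA
  rw [h1, koopmanFun, h2, mul_zero]
  rw [mem_translate, sub_neg_eq_add, add_comm]
  exact hA

/-- A linear functional on `L²` that extends a functional as in the definition of conformality. -/
theorem exists_functional_of_isConformal {t : ℝ} (hμ : IsConformalMeasure c β μ)
    (hW : ((semigroupOfMeasure hμ).twist c t).IsConformal c β) :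
    ∃ ψ : Lp ℂ 2 μ →ₗ[ℂ] ℂ,
      (∀ f, MemDomain f → ∀ a ∈ P,
        ψ (koopman hμ a f) = Complex.exp (-(Complex.I * t + β / 2) * c a) * ψ f) ∧
      (∀ a ∈ P, ∃ C : ℝ, ∀ f ∈ L2X μ, (∀ᵐ A ∂μ, a ∈ (A.1 : Set G) → f A = 0) →
        ‖ψ f‖ ≤ C * ‖f‖) ∧
      ∃ f, MemDomain f ∧ ψ f ≠ 0 := by
  obtain ⟨φ, hφ, hne, hc⟩ := hW
  obtain ⟨φ₁, h₁⟩ := LinearMap.exists_extend φ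
  obtain ⟨ψ, h₂⟩ := LinearMap.exists_extend φ₁
  have hψ : ∀ f : ((semigroupOfMeasure hμ).twist c t).domain, ψ ((f : L2X μ) : Lp ℂ 2 μ) = φ f :=
    fun f => (LinearMap.congr_fun h₂ f.1).trans (LinearMap.congr_fun h₁ f)
  have hadj : ∀ (a : P) (f : L2X μ), ((semigroupOfMeasure hμ).twist c t).adj a f = 0 ↔
      ∀ᵐ A ∂μ, (a : G) ∈ (A.1 : Set G) → (f : Lp ℂ 2 μ) A = 0 := fun a f => by
    rw [twist_adj_eq_zero_iff, semigroupOfMeasure_adj_eq_zero_iff]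
  refine ⟨ψ, ?_, ?_, ?_⟩
  · rintro f ⟨hf, b, hb, hfb⟩ a ha
    have hd : (⟨f, hf⟩ : L2X μ) ∈ ((semigroupOfMeasure hμ).twist c t).domain :=
      ⟨⟨b, hb⟩, (hadj ⟨b, hb⟩ _).2 hfb⟩
    have h3 := LinearMap.congr_fun (hc ⟨a, ha⟩) ⟨⟨f, hf⟩, hd⟩
    rw [LinearMap.comp_apply, ← hψ, LinearMap.smul_apply, ← hψ] at h3
    have h4 : (((((semigroupOfMeasure hμ).twist c t).opDomain ⟨a, ha⟩ ⟨⟨f, hf⟩, hd⟩ :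
        ((semigroupOfMeasure hμ).twist c t).domain) : L2X μ) : Lp ℂ 2 μ) =
        Complex.exp (Complex.I * (t * c a : ℝ)) • koopman hμ a f := rfl
    rw [h4, map_smul, smul_eq_mul, smul_eq_mul] at h3
    have h5 : Complex.exp (-(Complex.I * (t * c a : ℝ))) *
        (Complex.exp (Complex.I * (t * c a : ℝ)) * ψ (koopman hμ a f)) = ψ (koopman hμ a f) := by
      rw [← mul_assoc, ← Complex.exp_add]
      simp
    rw [← h5, h3, ← mul_assoc, Complex.ofReal_exp, ← Complex.exp_add]
    congr 2
    push_cast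
    ring
  · intro a ha
    obtain ⟨C, hC⟩ := hφ ⟨a, ha⟩
    refine ⟨C, fun f hf hfa => ?_⟩
    have h3 : ((semigroupOfMeasure hμ).twist c t).adj ⟨a, ha⟩ (⟨f, hf⟩ : L2X μ) = 0 :=
      (hadj ⟨a, ha⟩ _).2 hfa
    have := hC ⟨⟨f, hf⟩, ⟨a, ha⟩, h3⟩ h3
    rwa [← hψ] at this
  · by_contra! h
    refine hne (LinearMap.ext fun f => ?_)
    rw [← hψ]
    obtain ⟨a, ha⟩ := f.2
    exact h _ ⟨f.1.2, a, a.2, (hadj a _).1 ha⟩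

/-- The second condition says that `m a₀ + s` exceeds `n a₀` by an element of `P`, so conformality,
available only for `P`, can compare the functional at these two shifts. -/
theorem IsOrderUnit.exists_le_translate_mem_exhaustion {a₀ : G} (h : IsOrderUnit P a₀) (s : G)
    (n : ℕ) : ∃ N, ∀ m ≥ N, (∀ A ∈ exhaustion P a₀ n, translate s A ∈ exhaustion P a₀ m) ∧
      m • a₀ + s - n • a₀ ∈ P := by
  obtain ⟨N, hN⟩ := h.exists_forall_sub_mem (n • a₀ - s)
  obtain ⟨M, hM⟩ := h.exists_forall_sub_mem (n • a₀ + s)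
  refine ⟨max N M, fun m hm => ?_⟩
  have h1 := hN m ((le_max_left _ _).trans hm)
  have h2 := hM m ((le_max_right _ _).trans hm)
  refine ⟨fun A hA => ⟨?_, fun hmem => hA.2 ?_⟩, ?_⟩
  · rw [mem_translate]
    convert A.sub_mem h1 hA.1 using 1
    abel
  · rw [mem_translate] at hmem
    convert A.sub_mem h2 hmem using 1
    abel
  · convert h1 using 1
    abel

/-- A shift by `n a₀` carries the `n`-th exhausting set onto `X_u \ (X_u + 2n a₀)`, hence functions
supported on it into the domain of the functional. -/
theorem memDomain_koopman_nsmul {a₀ : G} (hμ : IsConformalMeasure c β μ) {n : ℕ}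
    {f : Lp ℂ 2 μ} (hf : ∀ᵐ A ∂μ, A ∉ exhaustion P a₀ n → f A = 0) :
    koopman hμ (n • a₀) f ∈ L2X μ ∧
      ∀ᵐ A ∂μ, (n • a₀ + n • a₀) ∈ (A.1 : Set G) → koopman hμ (n • a₀) f A = 0 := by
  constructor
  · change ∀ᵐ A ∂μ, _
    filter_upwards [koopman_coeFn hμ (n • a₀) f, (hμ.quasiMeasurePreserving (n • a₀)).ae hf]
      with A h1 h2 hA
    rw [h1, koopmanFun, h2, mul_zero]
    intro h
    have h' : -(n • a₀) - -(n • a₀) ∈ (A.1 : Set G) := h.1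
    rw [sub_self] at h'
    exact hA h'
  · filter_upwards [koopman_coeFn hμ (n • a₀) f, (hμ.quasiMeasurePreserving (n • a₀)).ae hf]
      with A h1 h2 hA
    rw [h1, koopmanFun, h2, mul_zero]
    intro h
    have h' : ¬ (n • a₀ - -(n • a₀) ∈ (A.1 : Set G)) := h.2
    rw [sub_neg_eq_add] at h'
    exact h' hA

theorem ae_eq_on_of_inner_eq {α : Type*} [MeasurableSpace α] {μ : Measure α} {S : Set α}
    (hS : MeasurableSet S) {f g : Lp ℂ 2 μ}
    (h : ∀ k : Lp ℂ 2 μ, (∀ᵐ x ∂μ, x ∉ S → k x = 0) → inner ℂ f k = inner ℂ g k) :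
    ∀ᵐ x ∂μ, x ∈ S → f x = g x := by
  have hsupp : ∀ᵐ x ∂μ, x ∉ S → cutLp μ S hS (f - g) x = 0 := by
    filter_upwards [cutLp_coeFn hS (f - g)] with x hx hxS
    rw [hx, Set.indicator_of_notMem hxS]
  have h0 : cutLp μ S hS (f - g) = 0 := by
    rw [← inner_self_eq_zero (𝕜 := ℂ), inner_cutLp_left, cutLp_eq_self hS hsupp, inner_sub_left,
      h _ hsupp, sub_self]
  filter_upwards [(cutLp_eq_zero_iff hS).1 h0, Lp.coeFn_sub f g] with x h1 h2 hx
  have := h1 hx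
  rwa [h2, Pi.sub_apply, sub_eq_zero] at this

/-- The functional of the conformality condition is given locally by integration against square
integrable functions, which fit together to a non-zero eigenfunction of the translations. -/
theorem exists_local_densities_of_isConformal {t : ℝ} {a₀ : G} (ha₀ : IsOrderUnit P a₀)
    (hμ : IsConformalMeasure c β μ)
    (hW : ((semigroupOfMeasure hμ).twist c t).IsConformal c β) :
    ∃ g : ℕ → Lp ℂ 2 μ,
      (∀ (s : G) (n : ℕ), ∃ N, ∀ m ≥ N,
        (∀ A ∈ exhaustion P a₀ n, translate s A ∈ exhaustion P a₀ m) ∧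
        ∀ᵐ A ∂μ, A ∈ exhaustion P a₀ n →
          g m (translate s A) = Complex.exp (Complex.I * (t * c s : ℝ)) * g n A) ∧
      ∃ n, ¬ ∀ᵐ A ∂μ, A ∈ exhaustion P a₀ n → g n A = 0 := by
  obtain ⟨ψ, hψ, hbd, hne⟩ := exists_functional_of_isConformal hμ hW
  -- The inverse of the multiplier of `ψ` under `U_a`: thus `e(a) ψ(U_a f)` does not depend on `a ∈
  -- P`, and serves to extend `ψ` to functions supported outside `X_u`.
  let e : G → ℂ := fun s => Complex.exp ((Complex.I * t + β / 2) * c s)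
  have he : ∀ s s', e (s + s') = e s * e s' := fun s s' => by
    simp only [e, map_add]
    rw [← Complex.exp_add]
    push_cast
    ring_nf
  have hψ' : ∀ f, MemDomain f → ∀ a ∈ P, e a * ψ (koopman hμ a f) = ψ f := by
    intro f hf a ha
    rw [hψ f hf a ha, ← mul_assoc, ← Complex.exp_add, neg_mul, add_neg_cancel, Complex.exp_zero,
      one_mul]
  have hP : ∀ n : ℕ, n • a₀ + n • a₀ ∈ P := fun n =>
    P.add_mem (P.nsmul_mem ha₀.mem n) (P.nsmul_mem ha₀.mem n)
  have hsupp : ∀ (n : ℕ) (f : Lp ℂ 2 μ), ∀ᵐ A ∂μ, A ∉ exhaustion P a₀ n →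
      cutLp μ _ (measurableSet_exhaustion a₀ n) f A = 0 := by
    intro n f
    filter_upwards [cutLp_coeFn (measurableSet_exhaustion a₀ n) f] with A hA hA'
    rw [hA, Set.indicator_of_notMem hA']
  -- The extended functional is bounded on functions supported on the `n`-th exhausting set; the
  -- cut-off makes it bounded on all of `L²`, where the Riesz theorem applies.
  have hRiesz : ∀ n : ℕ, ∃ g : Lp ℂ 2 μ, ∀ f : Lp ℂ 2 μ,
      (∀ᵐ A ∂μ, A ∉ exhaustion P a₀ n → f A = 0) →
      inner ℂ g f = e (n • a₀) * ψ (koopman hμ (n • a₀) f) := by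
    intro n
    obtain ⟨C, hC⟩ := hbd _ (hP n)
    let l : Lp ℂ 2 μ →ₗ[ℂ] ℂ := ψ ∘ₗ (koopman hμ (n • a₀)).toLinearMap ∘ₗ
      (cutLp μ _ (measurableSet_exhaustion a₀ n)).toLinearMap
    have hl : ∀ f, ‖l f‖ ≤ |C| * ‖f‖ := by
      intro f
      obtain ⟨h1, h2⟩ := memDomain_koopman_nsmul hμ (hsupp n f)
      refine (hC _ h1 h2).trans ?_
      rw [LinearIsometry.norm_map]
      exact mul_le_mul (le_abs_self C) (norm_cutLp_le _ f) (norm_nonneg _) (abs_nonneg _)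
    let L : Lp ℂ 2 μ →L[ℂ] ℂ := e (n • a₀) • l.mkContinuous |C| hl
    refine ⟨(InnerProductSpace.toDual ℂ (Lp ℂ 2 μ)).symm L, fun f hf => ?_⟩
    rw [InnerProductSpace.toDual_symm_apply]
    change e (n • a₀) * ψ (koopman hμ (n • a₀) (cutLp μ _ (measurableSet_exhaustion a₀ n) f)) = _
    rw [cutLp_eq_self (measurableSet_exhaustion a₀ n) hf]
  choose g hg using hRiesz
  refine ⟨g, fun s n => ?_, ?_⟩
  · obtain ⟨N, hN⟩ := ha₀.exists_le_translate_mem_exhaustion s n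
    refine ⟨N, fun m hm => ⟨(hN m hm).1, ?_⟩⟩
    obtain ⟨hsub, hmP⟩ := hN m hm
    -- The translation rule for the densities in weak form: both `g m` and `g n` represent the same
    -- extended functional, evaluated at `U_s f` and at `f`.
    have key : ∀ f : Lp ℂ 2 μ, (∀ᵐ A ∂μ, A ∉ exhaustion P a₀ n → f A = 0) →
        inner ℂ (koopman hμ (-s) (g m)) f =
          inner ℂ ((starRingEnd ℂ) (e (-s)) • g n) f := by
      intro f hf
      have h1 : ∀ᵐ A ∂μ, A ∉ exhaustion P a₀ m → koopman hμ s f A = 0 := by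
        filter_upwards [koopman_coeFn hμ s f, (hμ.quasiMeasurePreserving s).ae hf] with A h1 h2 hA
        rw [h1, koopmanFun, h2, mul_zero]
        intro h
        have := hsub _ h
        rw [translate_translate_neg] at this
        exact hA this
      have h2 : MemDomain (koopman hμ (n • a₀) f) :=
        ⟨(memDomain_koopman_nsmul hμ hf).1, _, hP n,
          (memDomain_koopman_nsmul hμ hf).2⟩
      have h3 := hψ' _ h2 _ hmP
      rw [← koopman_add, sub_add_cancel] at h3
      calc inner ℂ (koopman hμ (-s) (g m)) f
          = inner ℂ (koopman hμ (-s) (g m)) (koopman hμ (-s) (koopman hμ s f)) := by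
            rw [koopman_neg_koopman]
        _ = inner ℂ (g m) (koopman hμ s f) := LinearIsometry.inner_map_map _ _ _
        _ = e (m • a₀) * ψ (koopman hμ (m • a₀ + s) f) := by rw [hg m _ h1, koopman_add]
        _ = e (-s) * (e (n • a₀) * (e (m • a₀ + s - n • a₀) * ψ (koopman hμ (m • a₀ + s) f))) := by
            rw [← mul_assoc, ← mul_assoc, ← he, ← he]
            congr 2
            abel
        _ = inner ℂ ((starRingEnd ℂ) (e (-s)) • g n) f := by
            rw [h3, ← hg n f hf, inner_smul_left, Complex.conj_conj]
    filter_upwards [ae_eq_on_of_inner_eq (measurableSet_exhaustion a₀ n) key,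
      koopman_coeFn hμ (-s) (g m), Lp.coeFn_smul ((starRingEnd ℂ) (e (-s))) (g n)]
      with A h1 h2 h3 hA
    have h4 := h1 hA
    rw [h2, h3, koopmanFun, neg_neg, Pi.smul_apply, smul_eq_mul, Complex.ofReal_exp] at h4
    have h5 : Complex.exp ((-(β * c (-s) / 2) : ℝ)) * (Complex.exp ((β * c (-s) / 2 : ℝ)) *
        g m (translate s A)) = g m (translate s A) := by
      rw [← mul_assoc, ← Complex.exp_add]
      simp
    rw [← h5, h4, ← mul_assoc, ← Complex.exp_conj, ← Complex.exp_add]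
    congr 2
    simp only [map_mul, map_add, Complex.conj_I, Complex.conj_ofReal, map_neg, map_div₀,
      Complex.conj_ofNat]
    push_cast
    ring
  · obtain ⟨f, ⟨hf, a, ha, hfa⟩, hf0⟩ := hne
    obtain ⟨n, hn⟩ := ha₀.exists_forall_sub_mem a
    refine ⟨n, fun h => hf0 ?_⟩
    have h1 : ∀ᵐ A ∂μ, A ∉ exhaustion P a₀ n → f A = 0 := by
      filter_upwards [ae_eq_zero_of_notMem_XDiff hf hfa] with A hA hA'
      refine hA fun h => hA' ⟨?_, fun h' => h.2 ?_⟩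
      · simpa using A.sub_mem (P.nsmul_mem ha₀.mem n) h.1
      · simpa using A.sub_mem (hn n le_rfl) h'
    have h2 : inner ℂ (g n) f = 0 := by
      rw [L2.inner_def]
      refine integral_eq_zero_of_ae ?_
      filter_upwards [h, h1] with A h3 h4
      by_cases hA : A ∈ exhaustion P a₀ n
      · simp [h3 hA]
      · simp [h4 hA]
    rw [hg n f h1, hψ' f ⟨hf, a, ha, hfa⟩ _ (P.nsmul_mem ha₀.mem n)] at h2
    exact h2

/-- The local densities are glued by using, at each `A`, the first exhausting set that contains it.
The modulus of the result is invariant, hence a constant, non-zero since some density is; dividing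
by the modulus normalises it. -/
theorem exists_isEigenfunction_of_isConformal [LocallyCompactSpace G] [SecondCountableTopology G]
    [T2Space G] [SFinite μ] {t : ℝ} {a₀ : G} (ha₀ : IsOrderUnit P a₀)
    (hμ : IsConformalMeasure c β μ) (hμ_erg : IsErgodicMeasure μ)
    (hW : ((semigroupOfMeasure hμ).twist c t).IsConformal c β) :
    ∃ u : YSpace P → ℂ, Measurable u ∧ (∀ᵐ A ∂μ, ‖u A‖ = 1) ∧ IsEigenfunction μ c t u := by
  classical
  obtain ⟨g, hg, n₀, hn₀⟩ := exists_local_densities_of_isConformal ha₀ hμ hW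
  have hex : ∀ A : YSpace P, ∃ n, A ∈ exhaustion P a₀ n := fun A =>
    mem_iUnion.1 (ha₀.iUnion_exhaustion ▸ mem_univ A)
  let u : YSpace P → ℂ := fun A => g (Nat.find (hex A)) A
  have hu : Measurable u := Measurable.find (p := fun n A => A ∈ exhaustion P a₀ n)
    (fun n => (Lp.stronglyMeasurable (g n)).measurable)
    (fun n => measurableSet_exhaustion a₀ n) hex
  have hcompat : ∀ᵐ A ∂μ, ∀ n, A ∈ exhaustion P a₀ n → g n A = u A := by
    have h : ∀ i j : ℕ, ∀ᵐ A ∂μ, A ∈ exhaustion P a₀ i → A ∈ exhaustion P a₀ j →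
        g i A = g j A := by
      intro i j
      -- The rule for `s = 0` compares both densities with one of a common larger index.
      obtain ⟨N, hN⟩ := hg 0 i
      obtain ⟨M, hM⟩ := hg 0 j
      filter_upwards [(hN (max N M) (le_max_left _ _)).2, (hM (max N M) (le_max_right _ _)).2]
        with A h1 h2 hi hj
      have h3 := h1 hi
      have h4 := h2 hj
      simp only [map_zero, mul_zero, Complex.ofReal_zero, Complex.exp_zero, one_mul] at h3 h4
      rw [← h3, ← h4]
    filter_upwards [ae_all_iff.2 fun i => ae_all_iff.2 (h i)] with A hA n hn
    exact hA n _ hn (Nat.find_spec (hex A))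
  have heig : IsEigenfunction μ c t u := by
    intro s
    choose N hN using hg s
    filter_upwards [hcompat, (hμ.quasiMeasurePreserving' s).ae hcompat,
      ae_all_iff.2 fun n => (hN n (N n) le_rfl).2] with A h1 h2 h3
    obtain ⟨n, hn⟩ := hex A
    rw [← h1 n hn, ← h3 n hn, h2 (N n) ((hN n (N n) le_rfl).1 A hn)]
  obtain ⟨r, hr⟩ := hμ_erg.exists_ae_eq_const hu.norm fun s => by
    filter_upwards [heig s] with A hA
    rw [hA, norm_mul, mul_comm Complex.I, Complex.norm_exp_ofReal_mul_I, one_mul]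
  have hr0 : (r : ℂ) ≠ 0 := by
    rw [Complex.ofReal_ne_zero]
    rintro rfl
    refine hn₀ ?_
    filter_upwards [hr, hcompat] with A h1 h2 hA
    rw [h2 n₀ hA]
    exact norm_eq_zero.1 h1
  refine ⟨fun A => u A / ‖u A‖, by fun_prop, ?_, fun s => ?_⟩
  · filter_upwards [hr] with A hA
    rw [norm_div, Complex.norm_real, norm_norm, hA, div_self (by exact_mod_cast hr0)]
  · filter_upwards [heig s, hr, (hμ.quasiMeasurePreserving' s).ae hr] with A h1 h2 h3
    rw [h1] at h3 ⊢
    rw [h3, h2, mul_div_assoc]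

end Eigenfunctions

/-! ### Fourier injectivity, joint measurability and measurable selection -/

section Selection

open FourierTransform in
/-- The Fourier transform is injective on integrable functions. -/
theorem ae_eq_zero_of_fourier_eq_zero {k : ℝ → ℂ} (hk : Integrable k) (h : ∀ w, 𝓕 k w = 0) :
    k =ᵐ[volume] 0 := by
  refine ae_eq_zero_of_integral_contDiff_smul_eq_zero hk.locallyIntegrable fun g hg hgc => ?_
  let g₁ : SchwartzMap ℝ ℂ := (hgc.comp_left (g := fun x : ℝ => (x : ℂ)) rfl).toSchwartzMap
    (Complex.ofRealCLM.contDiff.comp hg)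
  -- Write the test function as the Fourier transform of a Schwartz function; moving the transform
  -- onto `k` makes the pairing vanish.
  let g₂ : SchwartzMap ℝ ℂ := 𝓕⁻ g₁
  have hflip := VectorFourier.integral_fourierIntegral_smul_eq_flip (L := innerₗ ℝ)
    (e := Real.fourierChar) (μ := volume) (ν := volume) Real.continuous_fourierChar
    continuous_inner hk (g₂.integrable (μ := volume))
  have h1 : ∀ w, VectorFourier.fourierIntegral Real.fourierChar volume (innerₗ ℝ) k w = 0 := h
  have h2 : VectorFourier.fourierIntegral Real.fourierChar volume (innerₗ ℝ).flip g₂ = g₁ := by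
    rw [flip_innerₗ]
    change 𝓕 (g₂ : ℝ → ℂ) = g₁
    rw [← SchwartzMap.fourier_coe]
    exact congrArg _ (FourierTransform.fourier_fourierInv_eq g₁)
  simp only [h1, h2, zero_smul, integral_zero] at hflip
  rw [hflip]
  refine integral_congr_ae (ae_of_all _ fun x => ?_)
  change g x • k x = k x • (g x : ℂ)
  rw [Complex.real_smul, smul_eq_mul, mul_comm]

/-- A measurable family of elements of `L²` is given by a jointly measurable function. -/
theorem exists_jointly_measurable {T Y : Type*} [MeasurableSpace T] [MeasurableSpace Y]
    {η : Measure Y} [SecondCountableTopology (Lp ℂ 2 η)] {f : T → Lp ℂ 2 η}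
    (hf : StronglyMeasurable f) :
    ∃ u : T → Y → ℂ, Measurable (Function.uncurry u) ∧ ∀ t, u t =ᵐ[η] f t := by
  classical
  let d : ℕ → Lp ℂ 2 η := denseSeq (Lp ℂ 2 η)
  have hex : ∀ (n : ℕ) (t : T), ∃ k, ‖d k - f t‖ < (1 / 2) ^ n := by
    intro n t
    obtain ⟨k, hk⟩ := (denseRange_denseSeq (Lp ℂ 2 η)).exists_dist_lt (f t)
      (show (0 : ℝ) < (1 / 2) ^ n by positivity)
    exact ⟨k, by rwa [← dist_eq_norm, dist_comm]⟩
  -- Approximate `f t` within `2^{-n}` by the first suitable member of a dense sequence. The errors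
  -- are summable in norm, so they tend to zero almost everywhere.
  let F : ℕ → T × Y → ℂ := fun n p => d (Nat.find (hex n p.1)) p.2
  have hF : ∀ n, Measurable (F n) := fun n =>
    Measurable.find (f := fun k (p : T × Y) => d k p.2)
      (p := fun k (p : T × Y) => ‖d k - f p.1‖ < (1 / 2) ^ n)
      (fun k => (Lp.stronglyMeasurable (d k)).measurable.comp measurable_snd)
      (fun k => measurableSet_lt
        ((stronglyMeasurable_const.sub hf).norm.measurable.comp measurable_fst) measurable_const)
      (fun p => hex n p.1)
  refine ⟨fun t A => limUnder atTop fun n => F n (t, A), ?_, fun t => ?_⟩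
  · exact (StronglyMeasurable.limUnder fun n => (hF n).stronglyMeasurable).measurable
  · let g : ℕ → Lp ℂ 2 η := fun n => d (Nat.find (hex n t)) - f t
    have hg : ∑' n, ‖g n‖ₑ ≠ ∞ := by
      have h1 : Summable fun n => ‖g n‖ := by
        refine Summable.of_nonneg_of_le (fun n => norm_nonneg _)
          (fun n => (Nat.find_spec (hex n t)).le) ?_
        exact summable_geometric_of_lt_one (by norm_num) (by norm_num)
      simp_rw [← ofReal_norm]
      exact h1.tsum_ofReal_ne_top
    filter_upwards [Lp.hasSum_coeFn_tsum hg, ae_all_iff.2 fun n =>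
      Lp.coeFn_sub (d (Nat.find (hex n t))) (f t)] with A h1 h2
    refine Tendsto.limUnder_eq ?_
    have h3 := h1.summable.tendsto_atTop_zero
    have h4 : ∀ n, F n (t, A) = g n A + f t A := fun n => by
      rw [h2 n, Pi.sub_apply, sub_add_cancel]
    simp_rw [h4]
    simpa using h3.add_const (f t A)

/-- Measurable selection from a closed family of lines in a separable Hilbert space. -/
theorem exists_measurable_selection {E : Type*} [NormedAddCommGroup E] [InnerProductSpace ℂ E]
    [CompleteSpace E] [SecondCountableTopology E] {δ : ℝ} (hδ : 0 < δ) {K : Set (ℝ × E)}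
    (hK : IsClosed K) (hsmul : ∀ t v (z : ℂ), (t, v) ∈ K → (t, z • v) ∈ K)
    (hline : ∀ t v w, (t, v) ∈ K → (t, w) ∈ K → v ≠ 0 → ∃ z : ℂ, w = z • v)
    (hne : ∀ t ∈ Icc 0 δ, ∃ v, (t, v) ∈ K ∧ v ≠ 0) :
    ∃ (T : Set ℝ) (f : ℝ → E), MeasurableSet T ∧ T ⊆ Icc 0 δ ∧ volume T ≠ 0 ∧
      StronglyMeasurable f ∧ ∀ t ∈ T, (t, f t) ∈ K ∧ f t ≠ 0 := by
  borelize E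
  -- Requiring inner product `1` with the `n`-th vector of a dense sequence picks at most one point
  -- on each line. The projection to `t` is therefore injective on this Borel set, and by
  -- Lusin–Souslin its image is Borel with measurable inverse.
  let B : ℕ → Set (ℝ × E) := fun n =>
    K ∩ {p | p.1 ∈ Icc 0 δ} ∩ {p | inner ℂ (denseSeq E n) p.2 = (1 : ℂ)}
  have hB : ∀ n, MeasurableSet (B n) := fun n =>
    ((hK.inter (isClosed_Icc.preimage continuous_fst)).inter
      (isClosed_eq (by fun_prop) continuous_const)).measurableSet
  have hne0 : ∀ n, ∀ p ∈ B n, p.2 ≠ 0 := by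
    rintro n p ⟨-, hp⟩ h0
    rw [mem_ofPred_eq, h0, inner_zero_right] at hp
    exact zero_ne_one hp
  have hinj : ∀ n, InjOn Prod.fst (B n) := by
    rintro n ⟨t, v⟩ hv ⟨t', w⟩ hw (rfl : t = t')
    obtain ⟨z, hz⟩ := hline t v w hv.1.1 hw.1.1 (hne0 n _ hv)
    have h1 : inner ℂ (denseSeq E n) v = (1 : ℂ) := hv.2
    have h2 : inner ℂ (denseSeq E n) w = (1 : ℂ) := hw.2
    rw [hz, inner_smul_right, h1, mul_one] at h2
    rw [hz, h2, one_smul]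
  have hemb : ∀ n, MeasurableEmbedding ((B n).domRestrict Prod.fst) := fun n =>
    continuous_fst.continuousOn.measurableEmbedding (hB n) (hinj n)
  have hcover : Icc 0 δ ⊆ ⋃ n, Prod.fst '' B n := by
    intro t ht
    obtain ⟨v, hv, hv0⟩ := hne t ht
    obtain ⟨n, hn⟩ : ∃ n, inner ℂ (denseSeq E n) v ≠ (0 : ℂ) := by
      by_contra! h
      have hcl : IsClosed {x : E | inner ℂ x v = (0 : ℂ)} :=
        isClosed_eq (by fun_prop) continuous_const
      have hv' : v ∈ {x : E | inner ℂ x v = (0 : ℂ)} :=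
        hcl.closure_subset_iff.2 (range_subset_iff.2 h) (denseRange_denseSeq E v)
      exact hv0 (inner_self_eq_zero.1 hv')
    refine mem_iUnion.2 ⟨n, (t, (inner ℂ (denseSeq E n) v)⁻¹ • v), ⟨⟨hsmul t v _ hv, ht⟩, ?_⟩, rfl⟩
    rw [mem_ofPred_eq, inner_smul_right, inv_mul_cancel₀ hn]
  -- Countably many images cover `[0, δ]`, so one has positive measure; a selection over that one
  -- suffices.
  obtain ⟨n, hn⟩ : ∃ n, volume (Prod.fst '' B n) ≠ 0 := by
    by_contra! h
    have := measure_mono_null hcover (measure_iUnion_null h)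
    rw [Real.volume_Icc, sub_zero, ENNReal.ofReal_eq_zero] at this
    exact absurd hδ this.not_gt
  obtain ⟨f, hf, hf'⟩ := (hemb n).exists_measurable_extend
    (g := fun p : B n => p.1.2) (measurable_snd.comp measurable_subtype_coe) fun _ => ⟨0⟩
  refine ⟨Prod.fst '' B n, f, ?_, ?_, hn, hf.stronglyMeasurable, ?_⟩
  · rw [← range_domRestrict]
    exact (hemb n).measurableSet_range
  · rintro _ ⟨p, hp, rfl⟩
    exact hp.1.2
  · rintro _ ⟨p, hp, rfl⟩
    have h1 : f p.1 = p.2 := congrFun hf' ⟨p, hp⟩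
    rw [h1]
    exact ⟨hp.1.1, hne0 n p hp⟩

end Selection

/-! ### A jointly measurable family of unimodular eigenfunctions -/

section EigenfunctionFamily

variable {G : Type*} [AddCommGroup G] [TopologicalSpace G] [IsTopologicalAddGroup G]
  {P : AddSubmonoid G} {c : G →+ ℝ} {β : ℝ} {μ : Measure (YSpace P)}

theorem IsEigenfunction.congr {t : ℝ} {u v : YSpace P → ℂ} (hu : IsEigenfunction μ c t u)
    (hμ : IsConformalMeasure c β μ) (h : u =ᵐ[μ] v) : IsEigenfunction μ c t v := by
  intro s
  filter_upwards [hu s, h, (hμ.quasiMeasurePreserving' s).ae h] with A h1 h2 h3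
  rw [← h2, ← h3, h1]

theorem IsEigenfunction.const_smul {t : ℝ} {u : YSpace P → ℂ} (hu : IsEigenfunction μ c t u)
    (z : ℂ) : IsEigenfunction μ c t (z • u) := by
  intro s
  filter_upwards [hu s] with A h1
  rw [Pi.smul_apply, Pi.smul_apply, h1, smul_eq_mul, smul_eq_mul]
  ring

/-- A convergent sequence in `L²` has a subsequence converging almost everywhere, also after
translation by quasi-invariance, so the eigenvalue equation passes to the limit. -/
theorem IsConformalMeasure.isClosed_isEigenfunction (hμ : IsConformalMeasure c β μ)
    {η : Measure (YSpace P)} (hη : ae η = ae μ) :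
    IsClosed {p : ℝ × Lp ℂ 2 η | IsEigenfunction μ c p.1 p.2} := by
  refine IsSeqClosed.isClosed fun x p hx hp s => ?_
  obtain ⟨ns, hns, hlim⟩ := (tendstoInMeasure_of_tendsto_Lp
    ((continuous_snd.tendsto p).comp hp)).exists_seq_tendsto_ae
  rw [hη] at hlim
  have ht : Tendsto (fun i => (x (ns i)).1) atTop (𝓝 p.1) :=
    ((continuous_fst.tendsto p).comp hp).comp hns.tendsto_atTop
  filter_upwards [hlim, (hμ.quasiMeasurePreserving' s).ae hlim,
    ae_all_iff.2 fun i => hx (ns i) s] with A h1 h2 h3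
  refine tendsto_nhds_unique h2 ?_
  have h4 : Tendsto (fun i => Complex.exp (Complex.I * ((x (ns i)).1 * c s : ℝ)) *
      (x (ns i)).2 A) atTop (𝓝 (Complex.exp (Complex.I * (p.1 * c s : ℝ)) * p.2 A)) := by
    refine Tendsto.mul ?_ h1
    have hcont : Continuous fun t : ℝ => Complex.exp (Complex.I * (t * c s : ℝ)) := by fun_prop
    exact (hcont.tendsto p.1).comp ht
  exact h4.congr fun i => (h3 i).symm

variable [LocallyCompactSpace G] [SecondCountableTopology G] [T2Space G]

theorem IsEigenfunction.exists_norm_ae_eq [SFinite μ] (hμ_erg : IsErgodicMeasure μ) {t : ℝ}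
    {u : YSpace P → ℂ} (hu : IsEigenfunction μ c t u) (hum : Measurable u) :
    ∃ r : ℝ, ∀ᵐ A ∂μ, ‖u A‖ = r :=
  hμ_erg.exists_ae_eq_const hum.norm fun s => by
    filter_upwards [hu s] with A hA
    rw [hA, norm_mul, mul_comm Complex.I, Complex.norm_exp_ofReal_mul_I, one_mul]

/-- The quotient of the two eigenfunctions is invariant, hence constant by ergodicity. This provides
the lines required for the selection. -/
theorem IsEigenfunction.exists_ae_eq_smul [SFinite μ] (hμ_erg : IsErgodicMeasure μ) {t : ℝ}
    {u v : YSpace P → ℂ} (hu : IsEigenfunction μ c t u) (hum : Measurable u)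
    (hv : IsEigenfunction μ c t v) (hvm : Measurable v) (hu0 : ¬ u =ᵐ[μ] 0) :
    ∃ z : ℂ, v =ᵐ[μ] z • u := by
  obtain ⟨r, hr⟩ := hu.exists_norm_ae_eq hμ_erg hum
  have hr0 : r ≠ 0 := by
    rintro rfl
    refine hu0 ?_
    filter_upwards [hr] with A hA
    exact norm_eq_zero.1 hA
  obtain ⟨z, hz⟩ := hμ_erg.exists_ae_eq_const (hvm.div hum) fun s => by
    filter_upwards [hu s, hv s] with A h1 h2
    rw [Pi.div_apply, Pi.div_apply, h1, h2, mul_div_mul_left _ _ (Complex.exp_ne_zero _)]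
  refine ⟨z, ?_⟩
  filter_upwards [hr, hz] with A h1 h2
  have h3 : u A ≠ 0 := norm_ne_zero_iff.1 (h1 ▸ hr0)
  rw [Pi.smul_apply, smul_eq_mul, ← h2, Pi.div_apply, div_mul_cancel₀ _ h3]

theorem exists_eigenfunction_family [SFinite μ] (hμ : IsConformalMeasure c β μ)
    (hμ_erg : IsErgodicMeasure μ) (hμ0 : μ ≠ 0) {δ : ℝ} (hδ : 0 < δ)
    (h : ∀ t ∈ Icc 0 δ, ∃ u : YSpace P → ℂ, Measurable u ∧ (∀ᵐ A ∂μ, ‖u A‖ = 1) ∧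
      IsEigenfunction μ c t u) :
    ∃ (T : Set ℝ) (k : ℝ → YSpace P → ℂ), MeasurableSet T ∧ T ⊆ Icc 0 δ ∧ volume T ≠ 0 ∧
      Measurable (Function.uncurry k) ∧ (∀ t A, ‖k t A‖ ≤ 1) ∧ (∀ t ∉ T, ∀ A, k t A = 0) ∧
      ∀ t ∈ T, (∀ᵐ A ∂μ, ‖k t A‖ = 1) ∧ IsEigenfunction μ c t (k t) := by
  classical
  have := YSpace.secondCountableTopology (P := P)
  -- An equivalent finite measure, so that unimodular eigenfunctions belong to `L²`.
  let η := μ.toFinite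
  have hη : ae η = ae μ := ae_toFinite
  have : NeBot (ae μ) := ae_neBot.2 hμ0
  have : IsFiniteMeasure η := inferInstanceAs (IsFiniteMeasure μ.toFinite)
  have : Fact ((2 : ℝ≥0∞) ≠ ∞) := ⟨by simp⟩
  have hm : ∀ f : Lp ℂ 2 η, Measurable f := fun f => (Lp.stronglyMeasurable f).measurable
  have hzero : ∀ f : Lp ℂ 2 η, f = 0 ↔ f =ᵐ[μ] 0 := fun f => by
    rw [Lp.eq_zero_iff_ae_eq_zero, EventuallyEq, EventuallyEq, hη]
  obtain ⟨T, f, hT, hTδ, hT0, hf, hfT⟩ := exists_measurable_selection (E := Lp ℂ 2 η) hδ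
    (hμ.isClosed_isEigenfunction hη)
    (fun t v z hv => by
      refine IsEigenfunction.congr (u := z • ⇑v) (IsEigenfunction.const_smul hv z) hμ ?_
      rw [EventuallyEq, ← hη]
      exact (Lp.coeFn_smul z v).symm)
    (fun t v w hv hw hv0 => by
      obtain ⟨z, hz⟩ := IsEigenfunction.exists_ae_eq_smul hμ_erg hv (hm v) hw (hm w)
        (fun h0 => hv0 ((hzero v).2 h0))
      refine ⟨z, Lp.ext ?_⟩
      rw [EventuallyEq, ← hη] at hz
      exact EventuallyEq.trans hz (Lp.coeFn_smul z v).symm)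
    (fun t ht => by
      obtain ⟨u, hu, hu1, hut⟩ := h t ht
      have hmem : MemLp u 2 η := MemLp.of_bound hu.aestronglyMeasurable 1 (by
        rw [hη]
        filter_upwards [hu1] with A hA
        exact hA.le)
      have hcoe : hmem.toLp u =ᵐ[μ] u := by
        rw [EventuallyEq, ← hη]
        exact hmem.coeFn_toLp
      refine ⟨hmem.toLp u, hut.congr hμ hcoe.symm, fun h0 => ?_⟩
      obtain ⟨A, h1, h2, h3⟩ := (hu1.and (hcoe.and ((hzero _).1 h0))).exists
      rw [← h2, h3] at h1
      simp at h1)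
  obtain ⟨u, hu, huf⟩ := exists_jointly_measurable hf
  simp only [EventuallyEq, hη] at huf
  -- Normalising pointwise bounds the family by `1` everywhere (division by zero gives zero), so
  -- every `k(·, A)` is integrable.
  let k : ℝ → YSpace P → ℂ := fun t A => if t ∈ T then u t A / ‖u t A‖ else 0
  refine ⟨T, k, hT, hTδ, hT0, ?_, ?_, ?_, ?_⟩
  · have h1 : Measurable fun p : ℝ × YSpace P => u p.1 p.2 / (‖u p.1 p.2‖ : ℂ) :=
      hu.div (Complex.measurable_ofReal.comp hu.norm)
    exact Measurable.ite (measurable_fst hT) h1 measurable_const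
  · intro t A
    by_cases ht : t ∈ T
    · simp only [k, if_pos ht, norm_div, Complex.norm_real, norm_norm]
      exact div_self_le_one _
    · simp [k, if_neg ht]
  · intro t ht A
    simp [k, if_neg ht]
  · intro t ht
    obtain ⟨hft, hf0⟩ := hfT t ht
    have hft' : IsEigenfunction μ c t (f t) := hft
    have hut : IsEigenfunction μ c t (u t) := hft'.congr hμ (EventuallyEq.symm (huf t))
    obtain ⟨r, hr⟩ := hft'.exists_norm_ae_eq hμ_erg (hm (f t))
    have hr0 : r ≠ 0 := by
      rintro rfl
      refine hf0 ((hzero _).2 ?_)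
      filter_upwards [hr] with A hA
      exact norm_eq_zero.1 hA
    have hur : ∀ᵐ A ∂μ, ‖u t A‖ = r := by
      filter_upwards [hr, huf t] with A h1 h2
      rw [h2, h1]
    refine ⟨?_, fun s => ?_⟩
    · filter_upwards [hur] with A hA
      simp only [k, if_pos ht, norm_div, Complex.norm_real, norm_norm]
      rw [hA, div_self hr0]
    · filter_upwards [hut s, hur, (hμ.quasiMeasurePreserving' s).ae hur] with A h1 h2 h3
      simp only [k, if_pos ht]
      rw [h3, h2, h1, mul_div_assoc]

end EigenfunctionFamily

/-! ### The invariant density via the Fourier transform in `t` -/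

section Density

variable {G : Type*} [AddCommGroup G] [TopologicalSpace G] [IsTopologicalAddGroup G]
  {P : AddSubmonoid G} {c : G →+ ℝ} {β : ℝ} {μ : Measure (YSpace P)}

open FourierTransform

/-- Decay at infinity confines the superlevel set to a compact set, on which the exponential is
integrable. -/
theorem lintegral_indicator_exp_lt_top {g : ℝ → ℂ} (hg : Tendsto g (cocompact ℝ) (𝓝 0)) {ε : ℝ}
    (hε : 0 < ε) (b : ℝ) :
    ∫⁻ w, {w | ε < ‖g w‖}.indicator (fun w => ENNReal.ofReal (Real.exp (b * w))) w < ∞ := by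
  have h1 : ∀ᶠ w in cocompact ℝ, ‖g w‖ < ε := by
    have := hg.norm
    rw [norm_zero] at this
    exact this.eventually (gt_mem_nhds hε)
  obtain ⟨C, hC, hCg⟩ := mem_cocompact.1 h1
  have hsub : {w | ε < ‖g w‖} ⊆ C := by
    intro w hw
    by_contra hwC
    exact lt_asymm hw (show ‖g w‖ < ε from hCg hwC)
  have hcont : Continuous fun w : ℝ => Real.exp (b * w) := by fun_prop
  calc ∫⁻ w, {w | ε < ‖g w‖}.indicator (fun w => ENNReal.ofReal (Real.exp (b * w))) w
      ≤ ∫⁻ w, C.indicator (fun w => ENNReal.ofReal (Real.exp (b * w))) w :=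
        lintegral_mono fun w => indicator_le_indicator_of_subset hsub (fun _ => zero_le) w
    _ = ∫⁻ w in C, ENNReal.ofReal (Real.exp (b * w)) := lintegral_indicator hC.measurableSet _
    _ < ∞ := (hcont.continuousOn.integrableOn_compact hC).lintegral_lt_top

theorem lintegral_indicator_exp_ne_zero {g : ℝ → ℂ} (hg : Continuous g) {ε : ℝ} {w₀ : ℝ}
    (hw₀ : ε < ‖g w₀‖) (b : ℝ) :
    ∫⁻ w, {w | ε < ‖g w‖}.indicator (fun w => ENNReal.ofReal (Real.exp (b * w))) w ≠ 0 := by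
  have ho : IsOpen {w | ε < ‖g w‖} := isOpen_lt continuous_const hg.norm
  rw [lintegral_indicator ho.measurableSet]
  refine (setLIntegral_pos_iff ?_).2 ?_ |>.ne'
  · fun_prop
  · have : Function.support (fun w => ENNReal.ofReal (Real.exp (b * w))) = univ := by
      ext w
      simp [Real.exp_pos]
    rw [this, univ_inter]
    exact ho.measure_pos _ ⟨w₀, hw₀⟩

theorem fourier_exp_mul (k : ℝ → ℂ) (a w : ℝ) :
    𝓕 (fun t => Complex.exp (Complex.I * (t * a : ℝ)) * k t) w = 𝓕 k (w - a / (2 * Real.pi)) := by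
  rw [Real.fourier_real_eq_integral_exp_smul, Real.fourier_real_eq_integral_exp_smul]
  refine integral_congr_ae (ae_of_all _ fun t => ?_)
  simp only [smul_eq_mul]
  rw [← mul_assoc, ← Complex.exp_add]
  congr 2
  push_cast
  have : (Real.pi : ℂ) ≠ 0 := by exact_mod_cast Real.pi_ne_zero
  field_simp
  ring

theorem exists_density_of_eigenfunctions [LocallyCompactSpace G] [SecondCountableTopology G]
    [T2Space G] [SFinite μ] (hμ : IsConformalMeasure c β μ)
    (hμ_erg : IsErgodicMeasure μ) (hμ0 : μ ≠ 0) {δ : ℝ} (hδ : 0 < δ)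
    (h : ∀ t ∈ Icc 0 δ, ∃ u : YSpace P → ℂ, Measurable u ∧ (∀ᵐ A ∂μ, ‖u A‖ = 1) ∧
      IsEigenfunction μ c t u) :
    ∃ h : YSpace P → ℝ≥0∞, Measurable h ∧ (∀ A, h A < ∞) ∧ (∀ᵐ A ∂μ, h A ≠ 0) ∧
      ∀ s : G, ∀ᵐ A ∂μ, h (translate s A) = ENNReal.ofReal (Real.exp (β * c s)) * h A := by
  obtain ⟨T, k, hT, hTδ, hT0, hk, hk1, hkT, hkE⟩ := exists_eigenfunction_family hμ hμ_erg hμ0 hδ h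
  have hkA : ∀ A, Measurable fun t => k t A := fun A => hk.comp measurable_prodMk_right
  have hTfin : volume T < ∞ := (measure_mono hTδ).trans_lt (by simp)
  have hint : ∀ A, Integrable fun t => k t A := fun A => by
    have h1 : IntegrableOn (fun t => k t A) T :=
      Measure.integrableOn_of_bounded hTfin.ne (hkA A).aestronglyMeasurable
        (ae_of_all _ fun t => hk1 t A)
    exact h1.integrable_of_forall_notMem_eq_zero fun t ht => hkT t ht A
  let J : YSpace P → ℝ → ℂ := fun A => 𝓕 fun t => k t A
  -- The Riemann–Lebesgue lemma.
  have hJ0 : ∀ A, Tendsto (J A) (cocompact ℝ) (𝓝 0) := fun A => Real.zero_at_infty_fourier _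
  have hJc : ∀ A, Continuous (J A) := fun A =>
    VectorFourier.fourierIntegral_continuous Real.continuous_fourierChar
      (L := innerₗ ℝ) continuous_inner (hint A)
  have hJm : Measurable (Function.uncurry J) := by
    have h1 : StronglyMeasurable fun q : (YSpace P × ℝ) × ℝ =>
        Complex.exp ((-2 * Real.pi * q.2 * q.1.2 : ℝ) * Complex.I) • k q.2 q.1.1 := by
      refine Measurable.stronglyMeasurable ?_
      have h2 : Measurable fun q : (YSpace P × ℝ) × ℝ => k q.2 q.1.1 :=
        hk.comp (measurable_snd.prodMk (measurable_fst.comp measurable_fst))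
      refine Measurable.smul (f := fun q : (YSpace P × ℝ) × ℝ =>
        Complex.exp ((-2 * Real.pi * q.2 * q.1.2 : ℝ) * Complex.I)) ?_ h2
      fun_prop
    have h2 := h1.integral_prod_right' (ν := volume)
    convert h2.measurable using 1
    ext p
    exact Real.fourier_real_eq_integral_exp_smul _ _
  have hJs : ∀ s : G, ∀ᵐ A ∂μ, ∀ w, J (translate s A) w = J A (w - c s / (2 * Real.pi)) := by
    intro s
    have h1 : ∀ᵐ A ∂μ, ∀ᵐ t, k t (translate s A) =
        Complex.exp (Complex.I * (t * c s : ℝ)) * k t A := by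
      refine (Measure.ae_ae_comm ?_).2 (ae_of_all _ fun t => ?_)
      · refine measurableSet_eq_fun ?_ (Measurable.mul (by fun_prop) (hk.comp measurable_swap))
        exact hk.comp (measurable_snd.prodMk ((measurable_translate s).comp measurable_fst))
      · by_cases ht : t ∈ T
        · exact (hkE t ht).2 s
        · exact ae_of_all _ fun A => by rw [hkT t ht, hkT t ht, mul_zero]
    filter_upwards [h1] with A hA w
    refine Eq.trans ?_ (fourier_exp_mul _ _ _)
    exact Real.fourier_congr_ae hA w
  -- For almost every `A`, `k(·, A)` is unimodular almost everywhere on `T`, which has positive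
  -- measure; injectivity of the Fourier transform does the rest.
  have hJne : ∀ᵐ A ∂μ, ∃ w, J A w ≠ 0 := by
    have h1 : ∀ᵐ A ∂μ, ∀ᵐ t, t ∈ T → ‖k t A‖ = 1 := by
      refine (Measure.ae_ae_comm ?_).2 (ae_of_all _ fun t => ?_)
      · have h2 : MeasurableSet {p : YSpace P × ℝ | p.2 ∈ T} := measurable_snd hT
        have h3 : MeasurableSet {p : YSpace P × ℝ | ‖k p.2 p.1‖ = 1} :=
          measurableSet_eq_fun (hk.comp measurable_swap).norm measurable_const
        exact h2.imp h3
      · by_cases ht : t ∈ T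
        · filter_upwards [(hkE t ht).1] with A hA _
          exact hA
        · exact ae_of_all _ fun A h => absurd h ht
    filter_upwards [h1] with A hA
    by_contra! h0
    refine hT0 (measure_eq_zero_iff_ae_notMem.2 ?_)
    filter_upwards [hA, ae_eq_zero_of_fourier_eq_zero (hint A) h0] with t h2 h3 ht
    have := h2 ht
    rw [h3] at this
    simp at this
  -- The weight `e^{2πβw}` is chosen so that the shift by `c(s)/2π` yields the factor `e^{βc(s)}`.
  let D : ℕ → YSpace P → ℝ≥0∞ := fun n A => ∫⁻ w, {w | 1 / ((n : ℝ) + 1) < ‖J A w‖}.indicator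
    (fun w => ENNReal.ofReal (Real.exp (2 * Real.pi * β * w))) w
  have hDm : ∀ n, Measurable (D n) := by
    intro n
    have h1 : MeasurableSet {p : YSpace P × ℝ | 1 / ((n : ℝ) + 1) < ‖J p.1 p.2‖} :=
      measurableSet_lt measurable_const hJm.norm
    have h2 : Measurable ({p : YSpace P × ℝ | 1 / ((n : ℝ) + 1) < ‖J p.1 p.2‖}.indicator
        fun p => ENNReal.ofReal (Real.exp (2 * Real.pi * β * p.2))) :=
      Measurable.indicator (by fun_prop) h1
    exact h2.lintegral_prod_right'
  have hDs : ∀ n (s : G), ∀ᵐ A ∂μ,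
      D n (translate s A) = ENNReal.ofReal (Real.exp (β * c s)) * D n A := by
    intro n s
    filter_upwards [hJs s] with A hA
    simp only [D, hA]
    rw [← lintegral_const_mul' _ _ (by simp), ← lintegral_sub_right_eq_self (fun w =>
      ENNReal.ofReal (Real.exp (β * c s)) * {w | 1 / ((n : ℝ) + 1) < ‖J A w‖}.indicator
        (fun w => ENNReal.ofReal (Real.exp (2 * Real.pi * β * w))) w) (c s / (2 * Real.pi))]
    refine lintegral_congr fun w => ?_
    by_cases hw : 1 / ((n : ℝ) + 1) < ‖J A (w - c s / (2 * Real.pi))‖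
    · rw [indicator_of_mem (by exact hw), indicator_of_mem (by exact hw),
        ← ENNReal.ofReal_mul (Real.exp_pos _).le, ← Real.exp_add]
      congr 2
      field_simp
      ring
    · rw [indicator_of_notMem (by exact hw), indicator_of_notMem (by exact hw), mul_zero]
  have hDne : ∀ᵐ A ∂μ, ∃ n, D n A ≠ 0 := by
    filter_upwards [hJne] with A ⟨w, hw⟩
    obtain ⟨n, hn⟩ := exists_nat_one_div_lt (norm_pos_iff.2 hw)
    exact ⟨n, lintegral_indicator_exp_ne_zero (hJc A) hn _⟩
  obtain ⟨n, hn⟩ : ∃ n, μ {A | D n A ≠ 0} ≠ 0 := by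
    by_contra! h0
    refine hμ0 (ae_eq_bot.1 (eventually_false_iff_eq_bot.1 ?_))
    filter_upwards [hDne, ae_all_iff.2 fun n => measure_eq_zero_iff_ae_notMem.1 (h0 n)]
      with A ⟨n, h1⟩ h2
    exact h2 n h1
  refine ⟨D n, hDm n, fun A => lintegral_indicator_exp_lt_top (hJ0 A) (by positivity) _, ?_, hDs n⟩
  -- The set where `D n` is non-zero is almost invariant and not null, hence co-null.
  refine (hμ_erg.null_or_conull (hDm n (measurableSet_singleton 0).compl) fun s => ?_).resolve_left hn
  filter_upwards [hDs n s] with A hA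
  change D n (translate s A) ≠ 0 ↔ D n A ≠ 0
  rw [hA, mul_ne_zero_iff]
  exact and_iff_right (by simpa using Real.exp_pos _)

end Density

end ConformalIsometries

/-! ### The equivalence of the four conditions -/

open ConformalIsometries
theorem proposition3 {G : Type*} [AddCommGroup G] [TopologicalSpace G] [IsTopologicalAddGroup G]
    [LocallyCompactSpace G] [SecondCountableTopology G] [T2Space G]
    (P : AddSubmonoid G) (hP_closed : IsClosed (P : Set G))
    (hP_sub : ∀ s : G, ∃ a ∈ P, ∃ b ∈ P, s = a - b)
    (hP_int : (P : Set G) ⊆ closure (interior (P : Set G)))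
    (hP_unit : ∃ a₀ ∈ interior (P : Set G), ∀ s : G, ∃ n : ℕ, 0 < n ∧
      n • a₀ - s ∈ interior (P : Set G))
    (c : G →+ ℝ) (hc : Continuous c) (β : ℝ) (hβ : β ≠ 0)
    (μ : Measure (YSpace P)) [μ.Regular] (hμ_ne : μ ≠ 0)
    (hμ : IsConformalMeasure c β μ) (hμ_erg : IsErgodicMeasure μ)
    {H : Type*} [NormedAddCommGroup H] [InnerProductSpace ℂ H] [CompleteSpace H]
    (V : IsometricSemigroup P H) (hV : V.UnitarilyEquivalent (semigroupOfMeasure hμ)) :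
    List.TFAE [
      ∃ ν : Measure (YSpace P), SigmaFinite ν ∧ IsInvariantMeasure ν ∧ ν ≪ μ ∧ μ ≪ ν,
      ∀ t : ℝ, V.UnitarilyEquivalent (V.twist c t),
      ∃ δ : ℝ, 0 < δ ∧ ∀ t ∈ Set.Icc 0 δ, V.UnitarilyEquivalent (V.twist c t),
      ∃ δ : ℝ, 0 < δ ∧ ∀ t ∈ Set.Icc 0 δ, (V.twist c t).IsConformal c β] := by

  obtain ⟨a₀, ha₀⟩ : ∃ a₀, IsOrderUnit P a₀ := hP_unit
  have hσ : SigmaFinite μ := ha₀.sigmaFinite μ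
  tfae_have 1 → 2
  | ⟨ν, hνσ, hν, hνμ, hμν⟩, t => by
    obtain ⟨F, hF, hFs⟩ := hμ.exists_translate_eq_add hβ hν hνμ hμν
    exact (hV.trans (unitarilyEquivalent_twist_of_translate_eq_add hμ hF hFs t)).trans
      (hV.twist c t).symm
  tfae_have 2 → 3
  | h => ⟨1, one_pos, fun t _ => h t⟩
  tfae_have 3 → 4
  | ⟨δ, hδ, h⟩ => ⟨δ, hδ, fun t ht =>
      ((hμ.isConformal_semigroupOfMeasure hμ_ne ha₀).of_unitarilyEquivalent
        (hV.symm)).of_unitarilyEquivalent (h t ht)⟩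
  tfae_have 4 → 1
  | ⟨δ, hδ, h⟩ => by
    obtain ⟨h, hh, hfin, hpos, hs⟩ := exists_density_of_eigenfunctions hμ hμ_erg hμ_ne hδ
      fun t ht => exists_isEigenfunction_of_isConformal ha₀ hμ hμ_erg
        ((h t ht).of_unitarilyEquivalent (hV.twist c t))
    exact ⟨μ.withDensity h,
      SigmaFinite.withDensity_of_ne_top (ae_of_all _ fun A => (hfin A).ne),
      hμ.isInvariantMeasure_withDensity hh hs, withDensity_absolutelyContinuous _ _,
      withDensity_absolutelyContinuous' hh.aemeasurable hpos⟩
  tfae_finish
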